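/- Let $R$ be a commutative artinian ring and let $\Lambda$ be an artin $R$-algebra, that is, an $R$-algebra that is finitely generated as an $R$-module. Let $\mathrm{mod}\,\Lambda$ be the category of finitely generated right $\Lambda$-modules, $\mathrm{K}^b(\mathrm{mod}\,\Lambda)$ its bounded homotopy category, and $D=\mathrm{Hom}_R(-,E)$, where $E$ is an injective envelope of the $R$-module $R/\mathrm{rad}\,R$. Let $\mathrm{mod}(\mathrm{mod}\,\Lambda)$ be the abelian category of coherent functors on $\mathrm{mod}\,\Lambda$, that is, of the contravariant additive functors $F$ from $\mathrm{mod}\,\Lambda$ to abelian groups for which there is an exact sequence $\mathrm{Hom}_\Lambda(-,X)\to\mathrm{Hom}_\Lambda(-,Y)\to F\to 0$ with $X,Y\in\mathrm{mod}\,\Lambda$. Then the triangulated category $\mathrm{K}^b(\mathrm{mod}\,\Lambda)$ has Serre duality. Precisely: 1. $\mathrm{K}^b(\mathrm{mod}\,\Lambda)$ is Hom-finite over $R$ (every Hom set is a finitely generated $R$-module) and Krull-Schmidt (every object is a finite direct sum of objects with local endomorphism rings). 2. The functor $\mathcal{Q}:\mathrm{K}^b(\mathrm{mod}\,\Lambda)\to\mathrm{D}^b(\mathrm{mod}(\mathrm{mod}\,\Lambda))$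 induced by the Yoneda embedding $M\mapsto\mathrm{Hom}_\Lambda(-,M)$ is an equivalence of triangulated categories. 3. For every $M\in\mathrm{mod}\,\Lambda$ the functor $D\,\mathrm{Hom}_\Lambda(M,-)$ is coherent, and there is a triangulated auto-equivalence $\mathcal{V}$ of $\mathrm{D}^b(\mathrm{mod}(\mathrm{mod}\,\Lambda))$ such that $\mathcal{V}\mathcal{Q}$ is isomorphic to the functor $\mathrm{K}^b(\mathrm{mod}\,\Lambda)\to\mathrm{D}^b(\mathrm{mod}(\mathrm{mod}\,\Lambda))$ that applies $M\mapsto D\,\mathrm{Hom}_\Lambda(M,-)$ in each degree. (Thus $\mathcal{V}$ extends $\mathrm{Hom}_\Lambda(-,M)\mapsto D\,\mathrm{Hom}_\Lambda(M,-)$.) 4. There is a triangulated auto-equivalence $\mathcal{U}$ of $\mathrm{K}^b(\mathrm{mod}\,\Lambda)$ with $\mathcal{Q}\,\mathcal{U}\cong\mathcal{V}\mathcal{Q}$, and $\mathcal{U}$ is a Serre functor: there are $R$-linear isomorphisms $$D\,\mathrm{Hom}_{\mathrm{K}^b(\mathrm{mod}\,\Lambda)}(X,Y)\;\cong\;\mathrm{Hom}_{\mathrm{K}^b(\mathrm{mod}\,\Lambda)}(Y,\mathcal{U}X)$$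 natural in $X$ and $Y$. -/

import Mathlib

open CategoryTheory Limits Opposite ZeroObject

universe w v u

noncomputable section

namespace KbSerre

/-! ### Bounded homotopy categories -/

section Bounded

variable (C : Type u) [Category.{v} C] [Preadditive C]

/-- The complexes in `K(C)` that vanish outside a bounded range of degrees. -/
def bounded : ObjectProperty (HomotopyCategory C (ComplexShape.up ℤ)) :=
  fun X ↦ (∃ a : ℤ, CochainComplex.IsStrictlyGE X.as a) ∧
    (∃ b : ℤ, CochainComplex.IsStrictlyLE X.as b)

instance [HasZeroObject C] : (bounded C).ContainsZero where
  exists_zero :=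
    ⟨(HomotopyCategory.quotient _ _).obj 0, Functor.map_isZero _ (isZero_zero _),
      ⟨0, inferInstanceAs (CochainComplex.IsStrictlyGE (0 : CochainComplex C ℤ) 0)⟩,
      ⟨0, inferInstanceAs (CochainComplex.IsStrictlyLE (0 : CochainComplex C ℤ) 0)⟩⟩

instance : (bounded C).IsStableUnderShift ℤ where
  isStableUnderShiftBy n :=
    { le_shift := by
        rintro ⟨K⟩ ⟨⟨a, ha⟩, ⟨b, hb⟩⟩
        change CochainComplex.IsStrictlyGE K a at ha
        change CochainComplex.IsStrictlyLE K b at hb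
        change bounded C ((shiftFunctor _ n).obj ((HomotopyCategory.quotient _ _).obj K))
        rw [HomotopyCategory.shift_quotient_obj]
        exact ⟨⟨a - n, CochainComplex.isStrictlyGE_shift K a n (a - n) (by lia)⟩,
          ⟨b - n, CochainComplex.isStrictlyLE_shift K b n (b - n) (by lia)⟩⟩ }

lemma bounded_mappingCone [HasBinaryBiproducts C] {K L : CochainComplex C ℤ} (f : K ⟶ L)
    (hK : bounded C ((HomotopyCategory.quotient _ _).obj K))
    (hL : bounded C ((HomotopyCategory.quotient _ _).obj L)) :
    bounded C ((HomotopyCategory.quotient _ _).obj (CochainComplex.mappingCone f)) := by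
  obtain ⟨⟨a, ha⟩, ⟨b, hb⟩⟩ := hK
  obtain ⟨⟨a', ha'⟩, ⟨b', hb'⟩⟩ := hL
  change K.IsStrictlyGE a at ha
  change K.IsStrictlyLE b at hb
  change L.IsStrictlyGE a' at ha'
  change L.IsStrictlyLE b' at hb'
  refine ⟨⟨min (a - 1) a', ?_⟩, ⟨max b b', ?_⟩⟩
  · exact CochainComplex.isStrictlyGE_mappingCone f a a' _ (by lia) (by lia)
  · change (CochainComplex.mappingCone f).IsStrictlyLE _
    rw [CochainComplex.isStrictlyLE_iff]
    intro i hi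
    simp only [CochainComplex.mappingCone.isZero_X_iff]
    exact ⟨K.isZero_of_isStrictlyLE b _, L.isZero_of_isStrictlyLE b' _⟩

instance [HasZeroObject C] [HasBinaryBiproducts C] :
    (bounded C).IsTriangulatedClosed₃ where
  ext₃' T hT h₁ h₂ := by
    obtain ⟨f : T.obj₁.as ⟶ T.obj₂.as, hf⟩ :=
      (HomotopyCategory.quotient _ _).map_surjective T.mor₁
    refine ⟨_, bounded_mappingCone C f h₁ h₂,
      ⟨Pretriangulated.Triangle.π₃.mapIso (Pretriangulated.isoTriangleOfIso₁₂ T _ hT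
        (HomotopyCategory.mappingCone_triangleh_distinguished f)
        (Iso.refl _) (Iso.refl _) ?_)⟩⟩
    exact (Category.comp_id _).trans (hf.symm.trans (Category.id_comp _).symm)

instance [HasZeroObject C] [HasBinaryBiproducts C] : (bounded C).IsTriangulated where
  toIsTriangulatedClosed₂ := .of_isTriangulatedClosed₃

/-- The bounded homotopy category `K^b(C)`. -/
abbrev Kb := (bounded C).FullSubcategory

variable {C} {D : Type*} [Category* D] [Preadditive D]

/-- The functor `K^b(C) ⥤ K^b(D)` which applies an additive functor termwise. -/
def mapKb (F : C ⥤ D) [F.Additive] : Kb C ⥤ Kb D :=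
  (bounded D).lift ((bounded C).ι ⋙ F.mapHomotopyCategory (ComplexShape.up ℤ)) (by
    rintro ⟨⟨K⟩, ⟨a, ha⟩, ⟨b, hb⟩⟩
    change CochainComplex.IsStrictlyGE K a at ha
    change CochainComplex.IsStrictlyLE K b at hb
    exact ⟨⟨a, inferInstanceAs (CochainComplex.IsStrictlyGE
        ((F.mapHomologicalComplex _).obj K) a)⟩,
      ⟨b, inferInstanceAs (CochainComplex.IsStrictlyLE
        ((F.mapHomologicalComplex _).obj K) b)⟩⟩)

end Bounded

/-! ### Bounded derived categories -/

section Derived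

variable (A : Type u) [Category.{v} A] [Abelian A] [HasDerivedCategory.{w} A]

/-- The bounded derived category `D^b(A)` of an abelian category. -/
abbrev Db := (DerivedCategory.TStructure.t (C := A)).bounded.FullSubcategory

/-- The localization functor `K^b(A) ⥤ D^b(A)`. -/
def localizationKb : Kb A ⥤ Db A :=
  ObjectProperty.lift _ ((bounded A).ι ⋙ DerivedCategory.Qh) (by
    rintro ⟨⟨K⟩, ⟨a, ha⟩, ⟨b, hb⟩⟩
    exact ⟨⟨a, ⟨⟨K, (DerivedCategory.quotientCompQhIso A).app K, ha⟩⟩⟩,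
      ⟨b, ⟨⟨K, (DerivedCategory.quotientCompQhIso A).app K, hb⟩⟩⟩⟩)

end Derived

/-! ### Coherent functors -/

section Coherent

variable (C : Type u) [Category.{v} C] [Preadditive C]

/-- A contravariant functor `F` from `C` to abelian groups is coherent if there is an exact
sequence `Hom(-, X) ⟶ Hom(-, Y) ⟶ F ⟶ 0`. Such a functor is automatically additive. -/
def coherent : ObjectProperty (Cᵒᵖ ⥤ AddCommGrpCat.{v}) :=
  fun F ↦ ∃ (X Y : C) (f : X ⟶ Y) (p : preadditiveYoneda.obj Y ⟶ F)
    (zero : preadditiveYoneda.map f ≫ p = 0),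
    (ShortComplex.mk (preadditiveYoneda.map f) p zero).Exact ∧ Epi p

/-- The category `mod C` of coherent functors. -/
abbrev Coh := (coherent C).FullSubcategory

variable {C}

instance : (preadditiveYoneda (C := C)).Additive where
  map_add := by
    intros
    ext
    exact Preadditive.comp_add _ _ _ _ _ _

lemma coherent_yoneda [HasZeroObject C] (X : C) : coherent C (preadditiveYoneda.obj X) := by
  refine ⟨0, X, 0, 𝟙 _, by simp, ?_, inferInstance⟩
  rw [ShortComplex.exact_iff_mono _ (by simp)]
  dsimp
  infer_instance

variable (C) in
/-- The Yoneda embedding `C ⥤ mod C`, sending `X` to `Hom(-, X)`. -/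
def yonedaCoh [HasZeroObject C] : C ⥤ Coh C :=
  (coherent C).lift preadditiveYoneda coherent_yoneda

instance [HasZeroObject C] : (yonedaCoh C).Additive where
  map_add := by
    intros
    ext : 1
    exact (preadditiveYoneda (C := C)).map_add

lemma yoneda_lift {X Y : C} {G : Cᵒᵖ ⥤ AddCommGrpCat.{v}} (q : preadditiveYoneda.obj Y ⟶ G)
    [Epi q] (t : preadditiveYoneda.obj X ⟶ G) :
    ∃ h : X ⟶ Y, preadditiveYoneda.map h ≫ q = t := by
  have hq : Epi (q.app (op X)) := inferInstance
  rw [AddCommGrpCat.epi_iff_surjective] at hq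
  obtain ⟨h, hh⟩ := hq ((t.app (op X)).hom (𝟙 X))
  refine ⟨h, ?_⟩
  ext Z (f : Z.unop ⟶ X)
  have h₁ := ConcreteCategory.congr_hom (q.naturality f.op) h
  have h₂ := ConcreteCategory.congr_hom (t.naturality f.op) (𝟙 X)
  have h₃ : (preadditiveYoneda.obj X).map f.op (𝟙 X) = f := Category.comp_id f
  have h₄ : (preadditiveYoneda.obj Y).map f.op h = f ≫ h := rfl
  have h₅ : q.app Z (f ≫ h) = G.map f.op (q.app (op X) h) := (congrArg (q.app Z) h₄).symm.trans h₁
  have h₆ : t.app Z f = G.map f.op (t.app (op X) (𝟙 X)) := (congrArg (t.app Z) h₃).symm.trans h₂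
  exact h₅.trans ((congrArg (G.map f.op) hh).trans h₆.symm)

instance {J : Type} [SmallCategory J] (G : J ⥤ C) :
    PreservesLimit G (preadditiveYoneda (C := C)) :=
  preservesLimit_of_evaluation _ _ fun k ↦ by
    have : PreservesLimitsOfSize.{0, 0} (preadditiveCoyoneda.obj k) :=
      preservesLimitsOfSize_shrink _
    exact inferInstanceAs (PreservesLimit G (preadditiveCoyoneda.obj k))

instance : (coherent C).IsClosedUnderIsomorphisms where
  of_iso := by
    rintro F G e ⟨X, Y, f, p, zero, hp, _⟩
    have zero' : preadditiveYoneda.map f ≫ p ≫ e.hom = 0 := by simp [reassoc_of% zero]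
    exact ⟨X, Y, f, p ≫ e.hom, zero', ShortComplex.exact_of_iso
      (S₁ := ShortComplex.mk _ _ zero) (S₂ := ShortComplex.mk _ _ zero')
      (ShortComplex.isoMk (Iso.refl _) (Iso.refl _) e (by simp) (by simp)) hp, inferInstance⟩

instance [HasBinaryBiproducts C] : (coherent C).IsClosedUnderCokernels where
  cokernels_le := by
    rintro _ ⟨f, k, hk, ⟨X₁, X₀, a, p, hp₀, hp, _⟩, ⟨Y₁, Y₀, b, q, hq₀, hq, _⟩⟩
    obtain ⟨h, hh⟩ := yoneda_lift q (p ≫ f)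
    have hπ : Epi k.π := Cofork.IsColimit.epi hk
    refine ⟨X₀ ⊞ Y₁, Y₀, biprod.desc h b, q ≫ k.π, ?_, ?_, inferInstance⟩
    · have : biprod.desc h b = biprod.fst ≫ h + biprod.snd ≫ b := by ext <;> simp
      rw [this, Functor.map_add, Functor.map_comp, Functor.map_comp,
        Preadditive.add_comp, Category.assoc, Category.assoc, reassoc_of% hh,
        reassoc_of% hq₀, CokernelCofork.condition]
      simp
    · rw [ShortComplex.exact_iff_exact_up_to_refinements]
      intro A (x : A ⟶ _) (hx : x ≫ q ≫ k.π = 0)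
      obtain ⟨A₁, π₁, _, x₁, h₁⟩ :=
        (CokernelCofork.IsColimit.comp_π_eq_zero_iff_up_to_refinements hk (x ≫ q)).1
          (by simpa using hx)
      obtain ⟨A₂, π₂, _, x₂, h₂⟩ := surjective_up_to_refinements_of_epi p x₁
      obtain ⟨A₃, π₃, _, x₃, h₃⟩ := hq.exact_up_to_refinements
        (π₂ ≫ π₁ ≫ x - x₂ ≫ preadditiveYoneda.map h) (by
          dsimp
          rw [Preadditive.sub_comp, Category.assoc, Category.assoc, Category.assoc, h₁, hh,
            reassoc_of% h₂, sub_self])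
      dsimp at x₃ h₃
      refine ⟨A₃, π₃ ≫ π₂ ≫ π₁, inferInstance,
        π₃ ≫ x₂ ≫ preadditiveYoneda.map biprod.inl + x₃ ≫ preadditiveYoneda.map biprod.inr, ?_⟩
      dsimp
      simp only [Preadditive.add_comp, Category.assoc, ← Functor.map_comp, biprod.inl_desc,
        biprod.inr_desc]
      rw [← h₃]
      simp

instance [HasPullbacks C] : (coherent C).IsClosedUnderKernels where
  kernels_le := by
    rintro _ ⟨f, k, hk, ⟨X₁, X₀, a, p, hp₀, hp, _⟩, ⟨Y₁, Y₀, b, q, hq₀, hq, _⟩⟩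
    obtain ⟨h, hh⟩ := yoneda_lift q (p ≫ f)
    have hι : Mono k.ι := Fork.IsLimit.mono hk
    have sq₁ := (IsPullback.of_hasPullback h b).map (preadditiveYoneda (C := C))
    have sq₂ := (IsPullback.of_hasPullback (pullback.fst h b) a).map
      (preadditiveYoneda (C := C))
    obtain ⟨r, hr⟩ := KernelFork.IsLimit.lift' hk
      (preadditiveYoneda.map (pullback.fst h b) ≫ p) (by
        rw [Category.assoc, ← hh, reassoc_of% sq₁.w, hq₀, comp_zero])
    refine ⟨_, _, pullback.fst (pullback.fst h b) a, r, ?_, ?_, ?_⟩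
    · rw [← cancel_mono k.ι, Category.assoc, hr, reassoc_of% sq₂.w, hp₀, comp_zero, zero_comp]
    · rw [ShortComplex.exact_iff_exact_up_to_refinements]
      intro A (x : A ⟶ _) (hx : x ≫ r = 0)
      obtain ⟨A₁, π₁, _, x₁, h₁⟩ := hp.exact_up_to_refinements
        (x ≫ preadditiveYoneda.map (pullback.fst h b)) (by
          dsimp
          rw [Category.assoc, ← hr, reassoc_of% hx, zero_comp])
      exact ⟨A₁, π₁, inferInstance, sq₂.lift (π₁ ≫ x) x₁ (by simpa using h₁), by simp⟩
    · rw [epi_iff_surjective_up_to_refinements]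
      intro A x
      obtain ⟨A₁, π₁, _, x₁, h₁⟩ := surjective_up_to_refinements_of_epi p (x ≫ k.ι)
      obtain ⟨A₂, π₂, _, x₂, h₂⟩ := hq.exact_up_to_refinements
        (x₁ ≫ preadditiveYoneda.map h) (by
          dsimp
          rw [Category.assoc, hh, ← reassoc_of% h₁, KernelFork.condition, comp_zero, comp_zero])
      refine ⟨A₂, π₂ ≫ π₁, inferInstance, sq₁.lift (π₂ ≫ x₁) x₂ (by simpa using h₂), ?_⟩
      rw [← cancel_mono k.ι]
      simp [hr, h₁]

instance [HasZeroObject C] : (coherent C).ContainsZero where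
  exists_zero := ⟨preadditiveYoneda.obj 0, Functor.map_isZero _ (isZero_zero C),
    coherent_yoneda 0⟩

lemma coherent_biprod [HasBinaryBiproducts C] {F G : Cᵒᵖ ⥤ AddCommGrpCat.{v}}
    (hF : coherent C F) (hG : coherent C G) : coherent C (F ⊞ G) := by
  obtain ⟨X₁, X₀, a, p, hp₀, hp, _⟩ := hF
  obtain ⟨Y₁, Y₀, b, q, hq₀, hq, _⟩ := hG
  let y := preadditiveYoneda (C := C)
  have w₁ : y.map (biprod.map a b) ≫ y.map biprod.fst = y.map biprod.fst ≫ y.map a := by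
    simp [← Functor.map_comp]
  have w₂ : y.map (biprod.map a b) ≫ y.map biprod.snd = y.map biprod.snd ≫ y.map b := by
    simp [← Functor.map_comp]
  have v₁ : y.map (biprod.inl : X₀ ⟶ X₀ ⊞ Y₀) ≫ y.map biprod.fst = 𝟙 _ := by
    simp [← Functor.map_comp]
  have v₂ : y.map (biprod.inr : Y₀ ⟶ X₀ ⊞ Y₀) ≫ y.map biprod.snd = 𝟙 _ := by
    simp [← Functor.map_comp]
  have v₃ : y.map (biprod.inl : X₀ ⟶ X₀ ⊞ Y₀) ≫ y.map biprod.snd = 0 := by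
    simp [← Functor.map_comp]
  have v₄ : y.map (biprod.inr : Y₀ ⟶ X₀ ⊞ Y₀) ≫ y.map biprod.fst = 0 := by
    simp [← Functor.map_comp]
  have v₅ : y.map (biprod.fst : X₀ ⊞ Y₀ ⟶ X₀) ≫ y.map biprod.inl +
      y.map biprod.snd ≫ y.map biprod.inr = 𝟙 _ := by
    simp [← Functor.map_comp, ← Functor.map_add]
  refine ⟨X₁ ⊞ Y₁, X₀ ⊞ Y₀, biprod.map a b,
    biprod.lift (y.map biprod.fst ≫ p) (y.map biprod.snd ≫ q), ?_, ?_, ?_⟩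
  · apply biprod.hom_ext
    · simpa [y, hp₀] using w₁ =≫ p
    · simpa [y, hq₀] using w₂ =≫ q
  · rw [ShortComplex.exact_iff_exact_up_to_refinements]
    intro A (x : A ⟶ y.obj (X₀ ⊞ Y₀)) (hx : x ≫ biprod.lift _ _ = 0)
    obtain ⟨A₁, π₁, _, x₁, h₁⟩ := hp.exact_up_to_refinements (x ≫ y.map biprod.fst)
      (by simpa using hx =≫ biprod.fst)
    obtain ⟨A₂, π₂, _, x₂, h₂⟩ := hq.exact_up_to_refinements (π₁ ≫ x ≫ y.map biprod.snd)
      (by simpa using π₁ ≫= hx =≫ biprod.snd)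
    dsimp at x₁ h₁ x₂ h₂
    refine ⟨A₂, π₂ ≫ π₁, inferInstance,
      π₂ ≫ x₁ ≫ y.map biprod.inl + x₂ ≫ y.map biprod.inr, ?_⟩
    have u₁ : y.map biprod.inl ≫ y.map (biprod.map a b) = y.map a ≫ y.map biprod.inl := by
      simp [← Functor.map_comp]
    have u₂ : y.map biprod.inr ≫ y.map (biprod.map a b) = y.map b ≫ y.map biprod.inr := by
      simp [← Functor.map_comp]
    replace h₁ : π₁ ≫ x ≫ y.map biprod.fst = x₁ ≫ y.map a := h₁
    replace h₂ : π₂ ≫ π₁ ≫ x ≫ y.map biprod.snd = x₂ ≫ y.map b := h₂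
    have key : (π₂ ≫ π₁) ≫ x = (π₂ ≫ x₁ ≫ y.map biprod.inl + x₂ ≫ y.map biprod.inr) ≫
        y.map (biprod.map a b) := by
      simp only [Preadditive.add_comp, Category.assoc, u₁, u₂]
      rw [← reassoc_of% h₁, ← reassoc_of% h₂, ← Preadditive.comp_add, ← Preadditive.comp_add,
        ← Preadditive.comp_add, v₅, Category.comp_id]
    exact key
  · rw [epi_iff_surjective_up_to_refinements]
    intro A x
    obtain ⟨A₁, π₁, _, x₁, h₁⟩ := surjective_up_to_refinements_of_epi p (x ≫ biprod.fst)
    obtain ⟨A₂, π₂, _, x₂, h₂⟩ := surjective_up_to_refinements_of_epi q (π₁ ≫ x ≫ biprod.snd)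
    refine ⟨A₂, π₂ ≫ π₁, inferInstance,
      π₂ ≫ x₁ ≫ y.map biprod.inl + x₂ ≫ y.map biprod.inr, ?_⟩
    apply biprod.hom_ext
    · simp [reassoc_of% v₁, reassoc_of% v₄, h₁]
    · simp [reassoc_of% v₂, reassoc_of% v₃, h₂]

instance [HasZeroObject C] [HasBinaryBiproducts C] :
    (coherent C).IsClosedUnderFiniteProducts := by
  have : (coherent C).IsClosedUnderBinaryProducts :=
    { limitsOfShape_le := by
        rintro X ⟨p⟩
        exact (coherent C).prop_of_iso
          (IsLimit.conePointsIsoOfNatIso p.isLimit (BinaryBiproduct.isLimit _ _)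
            (diagramIsoPair p.diag)).symm
          (coherent_biprod (p.prop_diag_obj _) (p.prop_diag_obj _)) }
  exact .mk'

-- Hence `Coh C` is abelian for abelian `C`, with kernels and cokernels computed pointwise.

end Coherent

/-! ### Serre functors -/

section Serre

variable (R : Type u) [CommRing R] (E : Type v) [AddCommGroup E] [Module R E]

/-- The contravariant functor `D = Hom_R(-, E)` on `R`-modules. -/
def dual : (ModuleCat.{v} R)ᵒᵖ ⥤ ModuleCat.{v} R :=
  (linearYoneda R (ModuleCat.{v} R)).obj (ModuleCat.of R E)

variable (T : Type w) [Category.{v} T] [Preadditive T] [Linear R T]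

/-- The bifunctor sending `X` and `Y` to `D Hom(X, Y)`. -/
def dualHom : T ⥤ Tᵒᵖ ⥤ ModuleCat.{v} R :=
  (linearCoyoneda R T).rightOp ⋙ Functor.opHom T (ModuleCat.{v} R) ⋙
    (Functor.whiskeringRight _ _ _).obj (dual R E)

variable {T} in
/-- An auto-equivalence `S` with bifunctorial isomorphisms `D Hom(X, Y) ≅ Hom(Y, S X)`. -/
def IsSerreFunctor (S : T ⥤ T) : Prop :=
  S.IsEquivalence ∧ Nonempty (dualHom R E T ≅ S ⋙ linearYoneda R T)

/-- The functor sending `M` to the contravariant functor `D Hom(M, -)`, with values in abelian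
groups. -/
def dualRepresentable : T ⥤ Tᵒᵖ ⥤ AddCommGrpCat.{v} :=
  dualHom R E T ⋙ (Functor.whiskeringRight _ _ _).obj (forget₂ (ModuleCat.{v} R) AddCommGrpCat.{v})

instance : (dualRepresentable R E T).Additive where
  map_add {X Y f g} := by
    ext Z φ
    refine ModuleCat.hom_ext (LinearMap.ext fun (t : Y ⟶ Z.unop) ↦ ?_)
    let φ' : (X ⟶ Z.unop) →ₗ[R] E := φ.hom
    change φ' ((f + g) ≫ t) = φ' (f ≫ t) + φ' (g ≫ t)
    rw [Preadditive.add_comp, map_add]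

variable {R E T}

/-- The functor `M ↦ D Hom(M, -)` from `T` to `mod T`, given that its values are coherent. -/
def dualRepresentableCoh (h : ∀ M : T, coherent T ((dualRepresentable R E T).obj M)) :
    T ⥤ Coh T :=
  (coherent T).lift (dualRepresentable R E T) h

instance (h : ∀ M : T, coherent T ((dualRepresentable R E T).obj M)) :
    (dualRepresentableCoh h).Additive where
  map_add := by
    intros
    ext : 1
    exact (dualRepresentable R E T).map_add

variable (R T)

/-- Every morphism module is finitely generated. -/
def IsHomFinite : Prop := ∀ X Y : T, Module.Finite R (X ⟶ Y)

end Serre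

/-- Every object is a finite direct sum of objects with local endomorphism rings. -/
def IsKrullSchmidt (T : Type w) [Category.{v} T] [Preadditive T] : Prop :=
  ∀ X : T, ∃ (n : ℕ) (Y : Fin n → T) (b : Bicone Y), Nonempty b.IsBilimit ∧
    Nonempty (X ≅ b.pt) ∧ ∀ i, IsLocalRing (End (Y i))

open Pretriangulated in
/-- An equivalence of triangulated categories. -/
def IsTriangleEquivalence {T : Type*} [Category* T] [HasZeroObject T] [HasShift T ℤ]
    [Preadditive T] [∀ n : ℤ, (shiftFunctor T n).Additive] [Pretriangulated T]
    {T' : Type*} [Category* T'] [HasZeroObject T'] [HasShift T' ℤ]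
    [Preadditive T'] [∀ n : ℤ, (shiftFunctor T' n).Additive] [Pretriangulated T']
    (F : T ⥤ T') : Prop :=
  F.IsEquivalence ∧ ∃ _ : F.CommShift ℤ, F.IsTriangulated

section Comparison

variable (C : Type u) [Category.{v} C] [Abelian C] [HasDerivedCategory.{w} (Coh C)]

/-- The functor `K^b(C) ⥤ D^b(mod C)` induced by the Yoneda embedding `X ↦ Hom(-, X)`. -/
def yonedaDb : Kb C ⥤ Db (Coh C) :=
  mapKb (yonedaCoh C) ⋙ localizationKb (Coh C)

variable {C} {R : Type*} [CommRing R] {E : Type v} [AddCommGroup E] [Module R E] [Linear R C]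

/-- The functor `K^b(C) ⥤ D^b(mod C)` induced by `X ↦ D Hom(X, -)`. -/
def dualRepresentableDb (h : ∀ X : C, coherent C ((dualRepresentable R E C).obj X)) :
    Kb C ⥤ Db (Coh C) :=
  mapKb (dualRepresentableCoh h) ⋙ localizationKb (Coh C)

end Comparison

/-! ### Modules over an artin algebra -/

section Artin

/-- `i : M → E` exhibits `E` as an injective envelope of `M`: `E` is injective and `i` is an
essential monomorphism. -/
structure IsInjectiveEnvelope {R : Type u} [Ring R] {M : Type v} [AddCommGroup M] [Module R M]
    {E : Type v} [AddCommGroup E] [Module R E] (i : M →ₗ[R] E) : Prop where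
  injective : Function.Injective i
  injective_module : Module.Injective R E
  essential : ∀ N : Submodule R E, N ⊓ LinearMap.range i = ⊥ → N = ⊥

lemma isNoetherianRing_op (R : Type u) [CommRing R] [IsArtinianRing R]
    (Λ : Type u) [Ring Λ] [Algebra R Λ] [Module.Finite R Λ] : IsNoetherianRing Λᵐᵒᵖ :=
  isNoetherian_of_tower R inferInstance

/-- The category `mod Λ` of finitely generated right modules over an `R`-algebra `Λ`. -/
def ModFG (R : Type u) [CommRing R] (Λ : Type u) [Ring Λ] [Algebra R Λ] : Type (u + 1) :=
  FGModuleCat.{u} Λᵐᵒᵖ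

variable (R : Type u) [CommRing R] (Λ : Type u) [Ring Λ] [Algebra R Λ]

instance : Category.{u} (ModFG R Λ) := inferInstanceAs (Category (FGModuleCat.{u} Λᵐᵒᵖ))

instance : Preadditive (ModFG R Λ) := inferInstanceAs (Preadditive (FGModuleCat.{u} Λᵐᵒᵖ))

instance [IsArtinianRing R] [Module.Finite R Λ] : Abelian (ModFG R Λ) :=
  have := isNoetherianRing_op R Λ
  inferInstanceAs (Abelian (FGModuleCat.{u} Λᵐᵒᵖ))

open scoped ModuleCat.Algebra in
/-- `R` acts on module homomorphisms through its image in the centre of `Λ`. -/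
instance : Linear R (ModFG R Λ) := inferInstanceAs (Linear R (FGModuleCat.{u} Λᵐᵒᵖ))

end Artin

end KbSerre

end

noncomputable section

namespace KbSerre

open Pretriangulated

/-! ### Triangle equivalences -/

section TriangleEquivalence

variable {T : Type*} [Category* T] [HasZeroObject T] [HasShift T ℤ]
    [Preadditive T] [∀ n : ℤ, (shiftFunctor T n).Additive] [Pretriangulated T]
    {T' : Type*} [Category* T'] [HasZeroObject T'] [HasShift T' ℤ]
    [Preadditive T'] [∀ n : ℤ, (shiftFunctor T' n).Additive] [Pretriangulated T']
    {T'' : Type*} [Category* T''] [HasZeroObject T''] [HasShift T'' ℤ]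
    [Preadditive T''] [∀ n : ℤ, (shiftFunctor T'' n).Additive] [Pretriangulated T'']

/-! Write C for mod Λ, y for the Yoneda embedding of C and ν M for D Hom(M, -). The Yoneda lemma
identifies Hom(y N, ν M) with D Hom(M, N) (`yonedaPairing`). This is the only source of duality; the
rest carries it over to complexes and proves that the functors involved are equivalences.

With signs (-1)^p, chain maps y L ⟶ ν K pair termwise with chain maps K ⟶ L. The pairing vanishes on
null-homotopic maps on either side, and injectivity of E makes every form on the homotopy classes of
maps K ⟶ L come from a unique homotopy class (`kbPairing_bijective`). Representable functors are
projective in mod C, so morphisms out of a bounded complex of them are the same in the homotopy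
category and in the derived category (`localizationKb_map_bijective`). Hence Q is fully faithful. It
is dense because every coherent functor has a resolution of length two by representables. If N
denotes termwise application of ν, then U = Q⁻¹N satisfies D Hom(X, Y) ≅ Hom(Y, U X).

It remains to see that N is an equivalence. Since the Hom modules are finite, they are reflexive
under D (`bijective_eval`), and this makes U, hence N, fully faithful (`DualPairing.map_bijective`).
Over an artin algebra the module Hom_R(Λⁿ, E) represents ν(Λⁿ). Projective presentations therefore
show that ν M is coherent, and injective copresentations give exact sequences 0 → y M → ν P₀ → ν P₁
→ ν T → 0 (`exists_dualRepresentable_coresolution`), so N is dense. The functor V is N Q⁻¹.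

The Krull-Schmidt property is proved for bounded complexes, where idempotents split because
complexes over C form an abelian category, and then passed along the full functor to K^b. -/

lemma IsTriangleEquivalence.comp {F : T ⥤ T'} {G : T' ⥤ T''} (hF : IsTriangleEquivalence F)
    (hG : IsTriangleEquivalence G) : IsTriangleEquivalence (F ⋙ G) := by
  obtain ⟨_, _, _⟩ := hF
  obtain ⟨_, _, _⟩ := hG
  exact ⟨inferInstance, inferInstance, inferInstance⟩

lemma IsTriangleEquivalence.symm {e : T ≌ T'} (h : IsTriangleEquivalence e.functor) :
    IsTriangleEquivalence e.inverse := by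
  obtain ⟨_, _, _⟩ := h
  let := e.commShiftInverse ℤ
  have := e.commShift_of_functor ℤ
  have := Equivalence.IsTriangulated.mk' e inferInstance
  exact ⟨inferInstance, inferInstance, inferInstance⟩

end TriangleEquivalence

/-! ### Termwise functors and localization are triangulated -/

section Triangulated

variable {C : Type*} [Category* C] [Preadditive C] {D : Type*} [Category* D] [Preadditive D]
  (F : C ⥤ D) [F.Additive]

instance : (mapKb F).CommShift ℤ :=
  inferInstanceAs (((bounded D).lift ((bounded C).ι ⋙ F.mapHomotopyCategory (.up ℤ)) _).CommShift ℤ)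

instance [HasZeroObject C] [HasBinaryBiproducts C] [HasZeroObject D] [HasBinaryBiproducts D] :
    (mapKb F).IsTriangulated :=
  (bounded D).isTriangulated_lift ((bounded C).ι ⋙ F.mapHomotopyCategory (.up ℤ)) _

variable (A : Type u) [Category.{v} A] [Abelian A] [HasDerivedCategory.{w} A]

instance : (localizationKb A).CommShift ℤ :=
  inferInstanceAs ((ObjectProperty.lift _ ((bounded A).ι ⋙ DerivedCategory.Qh) _).CommShift ℤ)

instance : (localizationKb A).IsTriangulated :=
  ObjectProperty.isTriangulated_lift _ ((bounded A).ι ⋙ DerivedCategory.Qh) _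

instance [F.Full] [F.Faithful] : (mapKb F).Full where
  map_surjective f :=
    ⟨ObjectProperty.homMk ((F.mapHomotopyCategory _).preimage f.hom), by
      ext
      exact (F.mapHomotopyCategory _).map_preimage f.hom⟩

instance [F.Full] [F.Faithful] : (mapKb F).Faithful where
  map_injective h := by
    ext
    exact (F.mapHomotopyCategory _).map_injective ((ObjectProperty.ι _).congr_map h)

end Triangulated

/-! ### Generation by complexes concentrated in degree zero -/

section Generation

variable {A : Type u} [Category.{v} A] [Abelian A]

open HomologicalComplex

/-- Induction on the number of degrees that may be nonzero: brutal truncation splits off the lowest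
term, and a degreewise split sequence of complexes gives a distinguished triangle in K. -/
lemma bounded_le_of_single (P : ObjectProperty (HomotopyCategory A (.up ℤ))) [P.IsTriangulated]
    [P.IsClosedUnderIsomorphisms]
    (h : ∀ M : A, P ((HomotopyCategory.singleFunctor A 0).obj M)) : bounded A ≤ P := by
  have hs (a : ℤ) (M : A) :
      P ((HomotopyCategory.quotient _ _).obj ((single A (.up ℤ) a).obj M)) := by
    have h' := P.le_shift (-a) _ (h M)
    exact P.prop_of_iso
      (((HomotopyCategory.singleFunctors A).shiftIso (-a) a 0 (by lia)).app M) h'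
  -- The range a, ..., a + n - 1 has n degrees; for n = 0 the complex is zero.
  have key (n : ℕ) : ∀ (a : ℤ) (K : CochainComplex A ℤ), K.IsStrictlyGE a →
      K.IsStrictlyLE (a + n - 1) → P ((HomotopyCategory.quotient _ _).obj K) := by
    induction n with
    | zero =>
      intro a K _ _
      have hK : IsZero K := by
        rw [IsZero.iff_id_eq_zero]
        ext i
        by_cases hi : i < a
        · exact (K.isZero_of_isStrictlyGE a i).eq_of_src _ _
        · exact (K.isZero_of_isStrictlyLE (a + (0 : ℕ) - 1) i (by push_cast; lia)).eq_of_src _ _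
      exact P.prop_of_isZero ((HomotopyCategory.quotient _ _).map_isZero hK)
    | succ n ih =>
      intro a K _ _
      -- The projection to the lowest degree is a chain map because nothing maps into degree a. Its
      -- kernel is the part of K in degrees above a.
      let g : K ⟶ (single A (.up ℤ) a).obj (K.X a) :=
        mkHomToSingle (𝟙 _) (fun i hi ↦
          (K.isZero_of_isStrictlyGE a i (by simp at hi; lia)).eq_of_src _ _)
      have hga : IsIso (g.f a) := by
        dsimp [g]
        rw [mkHomToSingle_f]
        infer_instance
      have hg (i : ℤ) : IsSplitEpi (g.f i) := by
        by_cases hi : i = a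
        · rw [hi]
          exact IsSplitEpi.of_iso (g.f a)
        · exact ⟨⟨⟨0, (isZero_single_obj_X (.up ℤ) a _ i hi).eq_of_src _ _⟩⟩⟩
      have : Epi g := epi_of_epi_f _ (fun i ↦ inferInstance)
      let S : ShortComplex (CochainComplex A ℤ) := .mk (kernel.ι g) g (kernel.condition g)
      have hS : S.ShortExact :=
        { exact := ShortComplex.exact_of_f_is_kernel _ (kernelIsKernel g) }
      have hS' (i : ℤ) := hS.map_of_exact (eval A (.up ℤ) i)
      let σ (i : ℤ) : (S.map (eval A (.up ℤ) i)).Splitting :=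
        .ofExactOfSection _ (hS' i).exact (hg i).exists_splitEpi.some.section_
          (hg i).exists_splitEpi.some.id (hS' i).mono_f
      have hT := (HomotopyCategory.distinguished_iff_iso_trianglehOfDegreewiseSplit _).2
        ⟨S, σ, ⟨Iso.refl _⟩⟩
      have hm (i : ℤ) : Mono ((kernel.ι g).f i) := (hS' i).mono_f
      have h₁ : P ((HomotopyCategory.quotient _ _).obj (kernel g)) := by
        refine ih (a + 1) _ ?_ ?_
        · rw [CochainComplex.isStrictlyGE_iff]
          intro i hi
          by_cases hia : i = a
          · subst hia
            have : (kernel.ι g).f i = 0 := by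
              rw [← cancel_mono (g.f i), ← comp_f, kernel.condition]
              simp
            exact IsZero.of_mono_eq_zero _ this
          · exact IsZero.of_mono ((kernel.ι g).f i) (K.isZero_of_isStrictlyGE a i (by lia))
        · rw [CochainComplex.isStrictlyLE_iff]
          intro i hi
          exact IsZero.of_mono ((kernel.ι g).f i)
            (K.isZero_of_isStrictlyLE (a + (n + 1 : ℕ) - 1) i (by push_cast; lia))
      exact P.ext_of_isTriangulatedClosed₂ _ hT h₁ (hs a (K.X a))
  rintro ⟨K⟩ ⟨⟨a, ha⟩, ⟨b, hb⟩⟩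
  change CochainComplex.IsStrictlyGE K a at ha
  change CochainComplex.IsStrictlyLE K b at hb
  exact key (b - a + 1).toNat a K ha (CochainComplex.isStrictlyLE_of_le K b _ (by lia))

variable {X₀ X₁ X₂ X₃ : A}

/-- Together with `shortExact_image_right`, this cuts an exact sequence 0 → X₀ → X₁ → X₂ → X₃ → 0 at
the image of its middle map, so that the two-out-of-three property for triangles can be applied
twice. -/
lemma shortExact_image_left {f : X₀ ⟶ X₁} {g : X₁ ⟶ X₂} {w₁ : f ≫ g = 0} [Mono f]
    (hfg : (ShortComplex.mk f g w₁).Exact) :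
    (ShortComplex.mk f (Abelian.factorThruImage g) (by
      rw [← cancel_mono (Abelian.image.ι g)]; simp [w₁])).ShortExact where
  exact := by
    let φ : ShortComplex.mk f (Abelian.factorThruImage g) (by
        rw [← cancel_mono (Abelian.image.ι g)]; simp [w₁]) ⟶ ShortComplex.mk f g w₁ :=
      { τ₁ := 𝟙 _
        τ₂ := 𝟙 _
        τ₃ := Abelian.image.ι g }
    have : Epi φ.τ₁ := inferInstanceAs (Epi (𝟙 X₀))
    have : IsIso φ.τ₂ := inferInstanceAs (IsIso (𝟙 X₁))
    have : Mono φ.τ₃ := inferInstanceAs (Mono (Abelian.image.ι g))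
    exact (ShortComplex.exact_iff_of_epi_of_isIso_of_mono φ).2 hfg

lemma shortExact_image_right {g : X₁ ⟶ X₂} {h : X₂ ⟶ X₃} {w₂ : g ≫ h = 0} [Epi h]
    (hgh : (ShortComplex.mk g h w₂).Exact) :
    (ShortComplex.mk (Abelian.image.ι g) h (by
      rw [← cancel_epi (Abelian.factorThruImage g)]; simp [w₂])).ShortExact where
  exact := by
    let φ : ShortComplex.mk g h w₂ ⟶ ShortComplex.mk (Abelian.image.ι g) h (by
        rw [← cancel_epi (Abelian.factorThruImage g)]; simp [w₂]) :=
      { τ₁ := Abelian.factorThruImage g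
        τ₂ := 𝟙 _
        τ₃ := 𝟙 _ }
    have : Epi φ.τ₁ := inferInstanceAs (Epi (Abelian.factorThruImage g))
    have : IsIso φ.τ₂ := inferInstanceAs (IsIso (𝟙 X₂))
    have : Mono φ.τ₃ := inferInstanceAs (Mono (𝟙 X₃))
    exact (ShortComplex.exact_iff_of_epi_of_isIso_of_mono φ).1 hgh

variable [HasDerivedCategory.{w} A]

lemma derivedCategory_bounded_le_of_single (P : ObjectProperty (DerivedCategory A))
    [P.IsTriangulated] [P.IsClosedUnderIsomorphisms]
    (h : ∀ M : A, P ((DerivedCategory.singleFunctor A 0).obj M)) :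
    DerivedCategory.TStructure.t.bounded ≤ P := by
  rintro X ⟨⟨a, ha⟩, ⟨b, hb⟩⟩
  have : X.IsGE a := ha
  have : X.IsLE b := hb
  obtain ⟨K, hK, hK', ⟨e⟩⟩ := X.exists_iso_Q_obj_of_isGE_of_isLE a b
  refine P.prop_of_iso e.symm (P.prop_of_iso ((DerivedCategory.quotientCompQhIso A).app K) ?_)
  exact bounded_le_of_single (P.inverseImage DerivedCategory.Qh) h
    ((HomotopyCategory.quotient _ _).obj K) ⟨⟨a, hK⟩, ⟨b, hK'⟩⟩

/-- The objects of an abelian category which belong to `P` when placed in degree zero. -/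
abbrev heartProperty (P : ObjectProperty (DerivedCategory A)) : ObjectProperty A :=
  P.inverseImage (DerivedCategory.singleFunctor A 0)

variable (P : ObjectProperty (DerivedCategory A)) [P.IsTriangulated] [P.IsClosedUnderIsomorphisms]

lemma heartProperty_X₁ {S : ShortComplex A} (hS : S.ShortExact) (h₂ : heartProperty P S.X₂)
    (h₃ : heartProperty P S.X₃) : heartProperty P S.X₁ :=
  P.ext_of_isTriangulatedClosed₁ _ hS.singleTriangle_distinguished h₂ h₃

lemma heartProperty_X₃ {S : ShortComplex A} (hS : S.ShortExact) (h₁ : heartProperty P S.X₁)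
    (h₂ : heartProperty P S.X₂) : heartProperty P S.X₃ :=
  P.ext_of_isTriangulatedClosed₃ _ hS.singleTriangle_distinguished h₁ h₂

lemma heartProperty_left {f : X₀ ⟶ X₁} {g : X₁ ⟶ X₂} {h : X₂ ⟶ X₃} {w₁ : f ≫ g = 0}
    {w₂ : g ≫ h = 0} [Mono f] [Epi h] (hfg : (ShortComplex.mk f g w₁).Exact)
    (hgh : (ShortComplex.mk g h w₂).Exact) (h₁ : heartProperty P X₁) (h₂ : heartProperty P X₂)
    (h₃ : heartProperty P X₃) : heartProperty P X₀ :=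
  heartProperty_X₁ P (shortExact_image_left hfg) h₁
    (heartProperty_X₁ P (shortExact_image_right hgh) h₂ h₃)

lemma heartProperty_right {f : X₀ ⟶ X₁} {g : X₁ ⟶ X₂} {h : X₂ ⟶ X₃} {w₁ : f ≫ g = 0}
    {w₂ : g ≫ h = 0} [Mono f] [Epi h] (hfg : (ShortComplex.mk f g w₁).Exact)
    (hgh : (ShortComplex.mk g h w₂).Exact) (h₀ : heartProperty P X₀) (h₁ : heartProperty P X₁)
    (h₂ : heartProperty P X₂) : heartProperty P X₃ :=
  heartProperty_X₃ P (shortExact_image_right hgh)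
    (heartProperty_X₃ P (shortExact_image_left hfg) h₀ h₁) h₂

end Generation

open Pretriangulated

/-! ### The bounded homotopy category and coherent functors -/

section YonedaEquivalence

variable (C : Type u) [Category.{v} C] [Abelian C]

/-- This allows exactness of coherent functors to be tested in the ambient functor category. -/
instance : (coherent C).ι.PreservesHomology where
  preservesKernels _ _ f := (coherent C).preservesKernels_ι f
  preservesCokernels _ _ f := (coherent C).preservesCokernels_ι f

instance : (yonedaCoh C).Full :=
  inferInstanceAs ((coherent C).lift preadditiveYoneda _).Full

instance : (yonedaCoh C).Faithful :=
  inferInstanceAs ((coherent C).lift preadditiveYoneda _).Faithful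

variable {C}

lemma coh_exact_iff (S : ShortComplex (Coh C)) : (S.map (coherent C).ι).Exact ↔ S.Exact :=
  S.exact_map_iff_of_faithful _

lemma coh_epi_iff {F G : Coh C} (f : F ⟶ G) : Epi f ↔ Epi f.hom := by
  have := (coherent C).preservesEpimorphisms_ι_of_isNormalMonoCategory
  exact ⟨fun _ ↦ inferInstanceAs (Epi ((coherent C).ι.map f)),
    fun h ↦ (coherent C).ι.epi_of_epi_map h⟩

/-- An epimorphism is surjective on values at X, and by Yoneda a morphism out of Hom(-, X) is an
element of such a value. -/
instance (X : C) : Projective ((yonedaCoh C).obj X) where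
  factors {F G} f e _ := by
    obtain ⟨_, Y, _, p, _, _, _⟩ := F.property
    have := (coh_epi_iff e).1 inferInstance
    obtain ⟨h, hh⟩ := yoneda_lift (p ≫ e.hom) f.hom
    refine ⟨ObjectProperty.homMk (preadditiveYoneda.map h ≫ p), ?_⟩
    ext : 1
    exact (Category.assoc _ _ _).trans hh

/-- Every coherent functor has a resolution of length two by representable functors. -/
lemma exists_yonedaCoh_resolution (F : Coh C) : ∃ (X Y : C) (f : X ⟶ Y)
    (p : (yonedaCoh C).obj Y ⟶ F) (zero : (yonedaCoh C).map f ≫ p = 0)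
    (zero' : (yonedaCoh C).map (kernel.ι f) ≫ (yonedaCoh C).map f = 0),
    (ShortComplex.mk _ _ zero').Exact ∧ (ShortComplex.mk _ _ zero).Exact ∧
    Epi p ∧ Mono ((yonedaCoh C).map (kernel.ι f)) := by
  obtain ⟨X, Y, f, p, zero, hp, hp'⟩ := F.property
  have w : preadditiveYoneda.map (kernel.ι f) ≫ preadditiveYoneda.map f = 0 := by
    rw [← Functor.map_comp, kernel.condition, Functor.map_zero]
  have w' : (yonedaCoh C).map (kernel.ι f) ≫ (yonedaCoh C).map f = 0 := by
    rw [← Functor.map_comp, kernel.condition, Functor.map_zero]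
  refine ⟨X, Y, f, ObjectProperty.homMk p, by ext : 1; exact zero, w', ?_, ?_, ?_, ?_⟩
  · rw [← coh_exact_iff]
    exact ShortComplex.exact_of_f_is_kernel (.mk _ _ w)
      (KernelFork.mapIsLimit _ (kernelIsKernel f) preadditiveYoneda)
  · rw [← coh_exact_iff]
    exact hp
  · rw [coh_epi_iff]
    exact hp'
  · have : Mono (preadditiveYoneda.map (kernel.ι f)) :=
      Fork.IsLimit.mono (KernelFork.mapIsLimit _ (kernelIsKernel f) preadditiveYoneda)
    exact (coherent C).ι.mono_of_mono_map this

variable [HasDerivedCategory.{w} (Coh C)]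

instance (K : CochainComplex C ℤ) (n : ℤ) :
    Projective ((((yonedaCoh C).mapHomologicalComplex (.up ℤ)).obj K).X n) :=
  inferInstanceAs (Projective ((yonedaCoh C).obj (K.X n)))

/-- A bounded above complex of projectives is K-projective, so inverting quasi-isomorphisms does not
change the morphisms out of it. -/
lemma localizationKb_map_bijective (X : Kb C) (F : Kb (Coh C)) :
    Function.Bijective ((localizationKb (Coh C)).map : ((mapKb (yonedaCoh C)).obj X ⟶ F) → _) := by
  obtain ⟨b, hb⟩ := X.property.2
  let L := ((yonedaCoh C).mapHomologicalComplex (.up ℤ)).obj X.obj.as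
  have : CochainComplex.IsStrictlyLE L b := inferInstanceAs
    (CochainComplex.IsStrictlyLE (((yonedaCoh C).mapHomologicalComplex _).obj X.obj.as) b)
  have := CochainComplex.isKProjective_of_projective L b
  have h := CochainComplex.IsKProjective.Qh_map_bijective L F.obj
  have h' := h.comp ((bounded (Coh C)).fullyFaithfulι.map_bijective ((mapKb (yonedaCoh C)).obj X) F)
  exact (Function.Bijective.of_comp_iff'
    ((DerivedCategory.TStructure.t (C := Coh C)).bounded.fullyFaithfulι.map_bijective _ _) _).1 h'

variable (C)

instance : (yonedaDb C).CommShift ℤ :=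
  inferInstanceAs ((mapKb (yonedaCoh C) ⋙ localizationKb (Coh C)).CommShift ℤ)

instance : (yonedaDb C).IsTriangulated :=
  inferInstanceAs (mapKb (yonedaCoh C) ⋙ localizationKb (Coh C)).IsTriangulated

lemma yonedaDb_map_bijective (X Y : Kb C) :
    Function.Bijective ((yonedaDb C).map : (X ⟶ Y) → _) :=
  (localizationKb_map_bijective X _).comp
    ((Functor.FullyFaithful.ofFullyFaithful (mapKb (yonedaCoh C))).map_bijective _ _)

instance : (yonedaDb C).Full where
  map_surjective {X Y} := (yonedaDb_map_bijective C X Y).2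

instance : (yonedaDb C).Faithful where
  map_injective {X Y} := @(yonedaDb_map_bijective C X Y).1

variable {C}

/-- A bounded complex concentrated in degree zero. -/
def singleKb (X : C) : Kb C :=
  ⟨(HomotopyCategory.singleFunctor C 0).obj X,
    ⟨0, inferInstanceAs (CochainComplex.IsStrictlyGE
      ((HomologicalComplex.single C (.up ℤ) 0).obj X) 0)⟩,
    ⟨0, inferInstanceAs (CochainComplex.IsStrictlyLE
      ((HomologicalComplex.single C (.up ℤ) 0).obj X) 0)⟩⟩

/-- Termwise application of `F` to a complex concentrated in degree zero. -/
def mapKbLocalizationSingleIso {A : Type*} [Category* A] [Abelian A] [HasDerivedCategory.{w} A]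
    (F : C ⥤ A) [F.Additive] (X : C) :
    ((mapKb F ⋙ localizationKb A).obj (singleKb X)).obj ≅
      (DerivedCategory.singleFunctor A 0).obj (F.obj X) :=
  DerivedCategory.Qh.mapIso ((HomotopyCategory.quotient A (.up ℤ)).mapIso
    ((HomologicalComplex.singleMapHomologicalComplex F (.up ℤ) 0).app X))

/-- The essential image of a full triangulated functor is a triangulated subcategory, and the
bounded derived category is generated by its heart. -/
lemma essSurj_of_heartProperty {T : Type*} [Category* T] [HasZeroObject T] [HasShift T ℤ]
    [Preadditive T] [∀ n : ℤ, (shiftFunctor T n).Additive] [Pretriangulated T]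
    {A : Type u} [Category.{v} A] [Abelian A] [HasDerivedCategory.{w} A]
    (F : T ⥤ Db A) [F.CommShift ℤ] [F.IsTriangulated] [F.Full] [F.Faithful]
    (h : ∀ M : A, heartProperty
      (F ⋙ (DerivedCategory.TStructure.t (C := A)).bounded.ι).essImage M) : F.EssSurj where
  mem_essImage X := by
    obtain ⟨Y, ⟨e⟩⟩ := derivedCategory_bounded_le_of_single _ h X.obj X.property
    exact ⟨Y, ⟨(DerivedCategory.TStructure.t (C := A)).bounded.fullyFaithfulι.preimageIso e⟩⟩

variable (C)

lemma isTriangleEquivalence_yonedaDb : IsTriangleEquivalence (yonedaDb C) := by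
  have : (yonedaDb C).EssSurj := essSurj_of_heartProperty _ (fun F ↦ by
    obtain ⟨X, Y, f, p, zero, zero', h₁, h₂, _, _⟩ := exists_yonedaCoh_resolution F
    have hy (M : C) : heartProperty (yonedaDb C ⋙
        (DerivedCategory.TStructure.t (C := Coh C)).bounded.ι).essImage
          ((yonedaCoh C).obj M) :=
      ⟨singleKb M, ⟨mapKbLocalizationSingleIso (yonedaCoh C) M⟩⟩
    exact heartProperty_right _ h₁ h₂ (hy _) (hy _) (hy _))
  exact ⟨{ }, inferInstance, inferInstance⟩

end YonedaEquivalence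

/-! ### Duality pairings -/

/-- A duality pairing between functors `F` and `G`: bijections from `Hom(F Y, G X)` to the
`E`-dual of `Hom(X, Y)` which are natural in `X` and `Y`. -/
structure DualPairing (R : Type*) [CommRing R] (E : Type*) [AddCommGroup E] [Module R E]
    {T : Type*} [Category* T] [Preadditive T] [Linear R T]
    {T' : Type*} [Category* T'] [Preadditive T'] (F G : T ⥤ T') where
  equiv (X Y : T) : (F.obj Y ⟶ G.obj X) ≃+ ((X ⟶ Y) →ₗ[R] E)
  equiv_map_left {X Y Y' : T} (b : Y ⟶ Y') (g : F.obj Y' ⟶ G.obj X) (f : X ⟶ Y) :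
    equiv X Y (F.map b ≫ g) f = equiv X Y' g (f ≫ b)
  equiv_map_right {X X' Y : T} (a : X ⟶ X') (g : F.obj Y ⟶ G.obj X) (f : X' ⟶ Y) :
    equiv X' Y (g ≫ G.map a) f = equiv X Y g (a ≫ f)

/-- The form g descends to the quotient by the kernel of f, which embeds in N; injectivity of E
extends it from there. -/
lemma exists_linearMap_extension {R : Type*} [CommRing R] {E : Type v} [AddCommGroup E]
    [Module R E] [Module.Injective R E] {M N : Type v} [AddCommGroup M] [Module R M]
    [AddCommGroup N] [Module R N] (f : M →ₗ[R] N) (g : M →ₗ[R] E)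
    (h : LinearMap.ker f ≤ LinearMap.ker g) : ∃ H : N →ₗ[R] E, ∀ x, H (f x) = g x := by
  obtain ⟨H, hH⟩ := Module.Injective.out (R := R) (Q := E) ((LinearMap.ker f).liftQ f le_rfl)
    (by
      rw [← LinearMap.ker_eq_bot]
      exact Submodule.ker_liftQ_eq_bot _ _ _ le_rfl)
    ((LinearMap.ker f).liftQ g h)
  exact ⟨H, fun x ↦ hH (Submodule.Quotient.mk x)⟩

namespace DualPairing

section Complexes

variable {R : Type*} [CommRing R] {E : Type v} [AddCommGroup E] [Module R E]
    {C : Type*} [Category.{v} C] [Preadditive C] [Linear R C]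
    {A : Type*} [Category* A] [Preadditive A] {F G : C ⥤ A} (e : DualPairing R E F G)

section

variable (R) (K L : CochainComplex C ℤ)

/-- The differential from families `K^p ⟶ L^p` to families `K^p ⟶ L^q`. -/
def homDiff : (∀ p, K.X p ⟶ L.X p) →ₗ[R] (∀ p q, K.X p ⟶ L.X q) where
  toFun z p q := z p ≫ L.d p q - K.d p q ≫ z q
  map_add' z z' := by
    ext p q
    simp only [Pi.add_apply, Preadditive.add_comp, Preadditive.comp_add]
    abel
  map_smul' r z := by
    ext p q
    simp [smul_sub]

/-- The inclusion of chain maps in families of morphisms. -/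
def homIncl : (K ⟶ L) →ₗ[R] (∀ p, K.X p ⟶ L.X p) where
  toFun f := f.f
  map_add' _ _ := rfl
  map_smul' _ _ := rfl

end

/-- Families with one nonzero entry. -/
def matSingle (R : Type*) [CommRing R] [Linear R C] (K L : CochainComplex C ℤ) (p q : ℤ) :
    (K.X p ⟶ L.X q) →ₗ[R] (∀ p q, K.X p ⟶ L.X q) :=
  LinearMap.single R (fun p ↦ ∀ q, K.X p ⟶ L.X q) p ∘ₗ
    LinearMap.single R (fun q ↦ K.X p ⟶ L.X q) q

variable {K L : CochainComplex C ℤ}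

lemma homDiff_single (p : ℤ) (f : K.X p ⟶ L.X p) :
    homDiff R K L (Pi.single p f) =
      matSingle R K L p (p + 1) (f ≫ L.d p (p + 1)) -
        matSingle R K L (p - 1) p (K.d (p - 1) p ≫ f) := by
  ext i j
  dsimp [homDiff, matSingle]
  congr 1
  · by_cases hi : i = p
    · subst hi
      by_cases hj : j = i + 1
      · subst hj; simp
      · simp [hj, L.shape i j (by simpa using Ne.symm hj)]
    · simp [hi]
  · by_cases hj : j = p
    · subst hj
      by_cases hi : i = j - 1
      · subst hi; simp
      · simp [hi, K.shape i j (by simp; lia)]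
    · by_cases hi : i = p - 1
      · subst hi; simp [hj]
      · simp [hi, hj]

lemma support_finite (hK : {p | ¬ IsZero (K.X p)}.Finite) {a : ℤ → E}
    (ha : ∀ p, IsZero (K.X p) → a p = 0) : (Function.support a).Finite :=
  hK.subset fun p hp hp' ↦ hp (ha p hp')

/-- This is why the pairing carries alternating signs: the two contributions of a homotopy in
neighbouring degrees cancel. The hypothesis `ht` makes the supports finite. -/
lemma finsum_telescope (hK : {p | ¬ IsZero (K.X p)}.Finite) (t : ℤ → ℤ → E)
    (ht : ∀ i j, IsZero (K.X j) → t i j = 0) :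
    ∑ᶠ p : ℤ, p.negOnePow • (t (p + 1) p + t p (p - 1)) = 0 := by
  have h : ∑ᶠ p : ℤ, p.negOnePow • t p (p - 1) = ∑ᶠ p : ℤ, - (p.negOnePow • t (p + 1) p) := by
    rw [← finsum_comp_equiv (Equiv.addRight (1 : ℤ))]
    simp [Int.negOnePow_succ]
  have h₁ : (Function.support fun p : ℤ ↦ p.negOnePow • t (p + 1) p).Finite :=
    support_finite hK fun p hp ↦ by simp [ht _ _ hp]
  have h₂ : (Function.support fun p : ℤ ↦ p.negOnePow • t p (p - 1)).Finite := by
    refine (h₁.image (fun p ↦ p + 1)).subset fun p hp ↦ ⟨p - 1, ?_, by simp⟩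
    intro h
    apply hp
    simpa [Int.negOnePow_sub] using h
  simp only [smul_add]
  rw [finsum_add_distrib h₁ h₂, h, finsum_neg_distrib, add_neg_cancel]

lemma linearMap_ext_single (hK : {p | ¬ IsZero (K.X p)}.Finite)
    {φ ψ : (∀ p, K.X p ⟶ L.X p) →ₗ[R] E}
    (h : ∀ p (f : K.X p ⟶ L.X p), φ (Pi.single p f) = ψ (Pi.single p f)) : φ = ψ := by
  ext z
  have hz : z = ∑ p ∈ hK.toFinset, Pi.single p (z p) := by
    ext q
    rw [Finset.sum_apply]
    by_cases hq : IsZero (K.X q)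
    · exact hq.eq_of_src _ _
    · rw [Finset.sum_eq_single q]
      · simp
      · intro p _ hp
        simp [hp.symm]
      · intro hq'
        simp [hq] at hq'
  rw [hz, map_sum, map_sum]
  exact Finset.sum_congr rfl fun p _ ↦ h p _

/-- The pairing of families `F(L^p) ⟶ G(K^p)` with families `K^p ⟶ L^p`, with alternating
signs. -/
def family (hK : {p | ¬ IsZero (K.X p)}.Finite) :
    (∀ p, F.obj (L.X p) ⟶ G.obj (K.X p)) →+ (∀ p, K.X p ⟶ L.X p) →ₗ[R] E where
  toFun g :=
    { toFun z := ∑ᶠ p : ℤ, p.negOnePow • e.equiv _ _ (g p) (z p)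
      map_add' z z' := by
        rw [← finsum_add_distrib]
        · simp
        all_goals
          exact support_finite hK fun p hp ↦ by simp [hp.eq_of_src _ 0]
      map_smul' r z := by
        rw [RingHom.id_apply, smul_finsum']
        · simp [smul_comm r]
        · exact support_finite hK fun p hp ↦ by simp [hp.eq_of_src _ 0] }
  map_zero' := by
    ext z
    simp
  map_add' g g' := by
    ext z
    simp only [LinearMap.coe_mk, AddHom.coe_mk, LinearMap.add_apply]
    rw [← finsum_add_distrib]
    · simp
    all_goals
      exact support_finite hK fun p hp ↦ by simp [hp.eq_of_src _ 0]

variable (hK : {p | ¬ IsZero (K.X p)}.Finite)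

lemma family_apply (g : ∀ p, F.obj (L.X p) ⟶ G.obj (K.X p)) (z : ∀ p, K.X p ⟶ L.X p) :
    e.family hK g z = ∑ᶠ p : ℤ, p.negOnePow • e.equiv _ _ (g p) (z p) := rfl

lemma family_single (g : ∀ p, F.obj (L.X p) ⟶ G.obj (K.X p)) (p : ℤ) (f : K.X p ⟶ L.X p) :
    e.family hK g (Pi.single p f) = p.negOnePow • e.equiv _ _ (g p) f := by
  rw [family_apply, finsum_eq_single _ p]
  · simp
  · intro q hq
    simp [hq]

lemma exists_family_eq (Ψ : (∀ p, K.X p ⟶ L.X p) →ₗ[R] E) :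
    ∃ g : ∀ p, F.obj (L.X p) ⟶ G.obj (K.X p), e.family hK g = Ψ := by
  refine ⟨fun p ↦ (e.equiv _ _).symm (p.negOnePow • Ψ ∘ₗ LinearMap.single R _ p),
    linearMap_ext_single hK fun p f ↦ ?_⟩
  rw [family_single, AddEquiv.apply_symm_apply, LinearMap.smul_apply, smul_smul]
  simp

variable [F.Additive] [G.Additive]

/-- The components of a chain map `F(L) ⟶ G(K)`. -/
def components
    (g : (F.mapHomologicalComplex (.up ℤ)).obj L ⟶ (G.mapHomologicalComplex (.up ℤ)).obj K)
    (p : ℤ) : F.obj (L.X p) ⟶ G.obj (K.X p) := g.f p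

lemma components_comm
    (g : (F.mapHomologicalComplex (.up ℤ)).obj L ⟶ (G.mapHomologicalComplex (.up ℤ)).obj K)
    (p q : ℤ) :
    components g p ≫ G.map (K.d p q) = F.map (L.d p q) ≫ components g q :=
  g.comm p q

/-- Writing f as dH + Hd and moving the differential of L across the pairing, by naturality and the
chain map relation for g, turns the sum into a telescoping one. -/
lemma family_eq_zero_of_homotopy_right
    (g : (F.mapHomologicalComplex (.up ℤ)).obj L ⟶ (G.mapHomologicalComplex (.up ℤ)).obj K)
    {f : K ⟶ L} (H : Homotopy f 0) : e.family hK (components g) f.f = 0 := by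
  rw [family_apply]
  refine Eq.trans (finsum_congr fun p ↦ ?_) (finsum_telescope hK
    (fun i j ↦ e.equiv _ _ (components g j) (K.d j i ≫ H.hom i j)) fun i j hj ↦ by
      rw [hj.eq_of_src (K.d j i ≫ H.hom i j) 0, map_zero])
  congr 1
  have h₁ := H.comm p
  rw [dNext_eq _ (show (ComplexShape.up ℤ).Rel p (p + 1) by simp),
    prevD_eq _ (show (ComplexShape.up ℤ).Rel (p - 1) p by simp)] at h₁
  have h₃ := DFunLike.congr_fun (congrArg (e.equiv _ _) (components_comm g (p - 1) p))
    (H.hom p (p - 1))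
  rw [e.equiv_map_left, e.equiv_map_right] at h₃
  rw [h₁, HomologicalComplex.zero_f, add_zero, map_add, h₃]

lemma family_eq_zero_of_homotopy_left
    {g : (F.mapHomologicalComplex (.up ℤ)).obj L ⟶ (G.mapHomologicalComplex (.up ℤ)).obj K}
    (H : Homotopy g 0) (f : K ⟶ L) : e.family hK (components g) f.f = 0 := by
  let h (i j : ℤ) : F.obj (L.X i) ⟶ G.obj (K.X j) := H.hom i j
  rw [family_apply]
  refine Eq.trans (finsum_congr fun p ↦ ?_) (finsum_telescope hK
    (fun i j ↦ e.equiv _ _ (h i j) (K.d j i ≫ f.f i)) fun i j hj ↦ by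
      rw [hj.eq_of_src (K.d j i ≫ f.f i) 0, map_zero])
  congr 1
  have h₁ := H.comm p
  rw [dNext_eq _ (show (ComplexShape.up ℤ).Rel p (p + 1) by simp),
    prevD_eq _ (show (ComplexShape.up ℤ).Rel (p - 1) p by simp),
    HomologicalComplex.zero_f, add_zero] at h₁
  replace h₁ : components g p = F.map (L.d p (p + 1)) ≫ h (p + 1) p +
    h p (p - 1) ≫ G.map (K.d (p - 1) p) := h₁
  rw [h₁, map_add, LinearMap.add_apply, e.equiv_map_left, e.equiv_map_right, f.comm]

/-- Chain maps are the kernel of `homDiff`. A form on families that kills them factors through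
`homDiff` and extends, by injectivity of E, to a form H on families K^p ⟶ L^q. The entries of H,
read through the pairing, are the components of a homotopy. -/
lemma exists_homotopy_of_family_eq_zero [Module.Injective R E]
    (g : (F.mapHomologicalComplex (.up ℤ)).obj L ⟶ (G.mapHomologicalComplex (.up ℤ)).obj K)
    (hg : ∀ f : K ⟶ L, e.family hK (components g) f.f = 0) : Nonempty (Homotopy g 0) := by
  obtain ⟨H, hH⟩ := exists_linearMap_extension (homDiff R K L) (e.family hK (components g)) (by
    intro z hz
    rw [LinearMap.mem_ker] at hz
    exact hg { f := z, comm' := fun i j _ ↦ sub_eq_zero.1 (congrFun (congrFun hz i) j) })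
  -- The sign (-1)^j compensates both the sign in `family` and the minus sign in `homDiff`.
  let h (i j : ℤ) (_ : (ComplexShape.up ℤ).Rel j i) : F.obj (L.X i) ⟶ G.obj (K.X j) :=
    (e.equiv _ _).symm (j.negOnePow • H ∘ₗ matSingle R K L j i)
  let h' : ∀ i j, (ComplexShape.up ℤ).Rel j i →
    (((F.mapHomologicalComplex (.up ℤ)).obj L).X i ⟶
      ((G.mapHomologicalComplex (.up ℤ)).obj K).X j) := h
  have key : g = Homotopy.nullHomotopicMap' h' := by
    ext p
    have h₁ : (ComplexShape.up ℤ).Rel p (p + 1) := by simp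
    have h₂ : (ComplexShape.up ℤ).Rel (p - 1) p := by simp
    rw [Homotopy.nullHomotopicMap'_f h₂ h₁]
    apply (e.equiv (K.X p) (L.X p)).injective
    change e.equiv _ _ (components g p) = e.equiv _ _ (F.map (L.d p (p + 1)) ≫ h (p + 1) p h₁ +
      h p (p - 1) h₂ ≫ G.map (K.d (p - 1) p))
    ext f
    have h₃ := hH (Pi.single p f)
    rw [family_single, homDiff_single, map_sub] at h₃
    rw [map_add, LinearMap.add_apply, e.equiv_map_left, e.equiv_map_right]
    simp only [h, AddEquiv.apply_symm_apply, LinearMap.smul_apply, LinearMap.comp_apply]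
    have h₄ : (p - 1).negOnePow = - p.negOnePow := by
      rw [Int.negOnePow_sub, Int.negOnePow_one, mul_neg, mul_one]
    rw [h₄, Units.neg_smul, ← sub_eq_add_neg, ← smul_sub, h₃, smul_smul]
    simp
  exact ⟨(Homotopy.ofEq key).trans (Homotopy.nullHomotopy' h')⟩

/-- Injectivity of E extends ψ from chain maps to all families, which yields components g p. That
they commute with the differentials is exactly the vanishing of ψ on null-homotopic maps. -/
lemma exists_family_eq_of_homotopy [Module.Injective R E] (ψ : (K ⟶ L) →ₗ[R] E)
    (hψ : ∀ f : K ⟶ L, Homotopy f 0 → ψ f = 0) :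
    ∃ g : (F.mapHomologicalComplex (.up ℤ)).obj L ⟶ (G.mapHomologicalComplex (.up ℤ)).obj K,
      ∀ f : K ⟶ L, e.family hK (components g) f.f = ψ f := by
  obtain ⟨Ψ, hΨ⟩ := exists_linearMap_extension (homIncl R K L) ψ (by
    intro f hf
    have : f = 0 := by
      ext p
      exact congrFun (LinearMap.mem_ker.1 hf) p
    rw [this]
    exact zero_mem _)
  obtain ⟨g, hg⟩ := e.exists_family_eq hK Ψ
  refine ⟨{ f := g, comm' := ?_ }, fun f ↦ (DFunLike.congr_fun hg f.f).trans (hΨ f)⟩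
  rintro p _ rfl
  apply (e.equiv (K.X (p + 1)) (L.X p)).injective
  change e.equiv _ _ (g p ≫ G.map (K.d p (p + 1))) =
    e.equiv _ _ (F.map (L.d p (p + 1)) ≫ g (p + 1))
  ext f
  rw [e.equiv_map_left, e.equiv_map_right]
  -- The homotopy with the single entry f : K^(p+1) ⟶ L^p. Its null-homotopic map lives in degrees p
  -- and p + 1, whose opposite signs produce the commutation relation evaluated at f.
  let hom : ∀ i j, (ComplexShape.up ℤ).Rel j i → (K.X i ⟶ L.X j) := fun i j _ ↦
    matSingle R K L (p + 1) p f i j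
  have h₁ := hψ _ (Homotopy.nullHomotopy' hom)
  rw [← hΨ, ← hg] at h₁
  have h₂ : homIncl R K L (Homotopy.nullHomotopicMap' hom) =
      Pi.single (M := fun p ↦ K.X p ⟶ L.X p) p (K.d p (p + 1) ≫ f) +
        Pi.single (M := fun p ↦ K.X p ⟶ L.X p) (p + 1) (f ≫ L.d p (p + 1)) := by
    ext i
    change (Homotopy.nullHomotopicMap' hom).f i = _
    rw [Homotopy.nullHomotopicMap'_f (show (ComplexShape.up ℤ).Rel (i - 1) i by simp)
      (show (ComplexShape.up ℤ).Rel i (i + 1) by simp), Pi.add_apply]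
    dsimp [hom, matSingle]
    congr 1
    · by_cases hi : i = p
      · subst hi; simp
      · simp [hi]
    · by_cases hi : i = p + 1
      · subst hi
        have (q : ℤ) (hq : q = p) : Pi.single (M := fun q ↦ K.X (p + 1) ⟶ L.X q) p f q ≫
            L.d q (p + 1) = f ≫ L.d p (p + 1) := by
          subst hq; simp
        simpa using this _ (by lia)
      · simp [hi]
  rw [h₂, map_add, family_single, family_single, Int.negOnePow_succ, Units.neg_smul,
    ← sub_eq_add_neg, ← smul_sub] at h₁
  rwa [smul_eq_zero_iff_eq, sub_eq_zero] at h₁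

end Complexes

end DualPairing

lemma finite_support_of_bounded {C : Type*} [Category* C] [Preadditive C] (X : Kb C) :
    {p | ¬ IsZero (X.obj.as.X p)}.Finite := by
  obtain ⟨⟨K⟩, ⟨a, ha⟩, ⟨b, hb⟩⟩ := X
  change CochainComplex.IsStrictlyGE K a at ha
  change CochainComplex.IsStrictlyLE K b at hb
  refine (Set.finite_Icc a b).subset fun p hp ↦ ⟨?_, ?_⟩
  · by_contra! h
    exact hp (CochainComplex.isZero_of_isStrictlyGE K a p h)
  · by_contra! h
    exact hp (CochainComplex.isZero_of_isStrictlyLE K b p h)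

namespace DualPairing

section Kb

variable {R : Type*} [CommRing R] {E : Type v} [AddCommGroup E] [Module R E]
    {C : Type*} [Category.{v} C] [Preadditive C] [Linear R C]
    {A : Type*} [Category* A] [Preadditive A] {F G : C ⥤ A} (e : DualPairing R E F G)
    [F.Additive] [G.Additive]

/-- The pairing of a chain map `F(L) ⟶ G(K)` with chain maps `K ⟶ L`. -/
def chainPairing {K L : CochainComplex C ℤ} (hK : {p | ¬ IsZero (K.X p)}.Finite) :
    ((F.mapHomologicalComplex (.up ℤ)).obj L ⟶ (G.mapHomologicalComplex (.up ℤ)).obj K) →+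
      (K ⟶ L) →ₗ[R] E where
  toFun g := e.family hK (components g) ∘ₗ homIncl R K L
  map_zero' := by
    rw [show components (0 : (F.mapHomologicalComplex (.up ℤ)).obj L ⟶
      (G.mapHomologicalComplex (.up ℤ)).obj K) = 0 from rfl, map_zero, LinearMap.zero_comp]
  map_add' g g' := by
    rw [show components (g + g') = components g + components g' from rfl, map_add,
      LinearMap.add_comp]

lemma chainPairing_apply {K L : CochainComplex C ℤ} (hK : {p | ¬ IsZero (K.X p)}.Finite)
    (g : (F.mapHomologicalComplex (.up ℤ)).obj L ⟶ (G.mapHomologicalComplex (.up ℤ)).obj K)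
    (f : K ⟶ L) :
    e.chainPairing hK g f = ∑ᶠ p : ℤ, p.negOnePow • e.equiv _ _ (components g p) (f.f p) := rfl

lemma chainPairing_eq {K L : CochainComplex C ℤ} (hK : {p | ¬ IsZero (K.X p)}.Finite)
    {g g' : (F.mapHomologicalComplex (.up ℤ)).obj L ⟶ (G.mapHomologicalComplex (.up ℤ)).obj K}
    (hg : (HomotopyCategory.quotient _ _).map g = (HomotopyCategory.quotient _ _).map g')
    {f f' : K ⟶ L}
    (hf : (HomotopyCategory.quotient _ _).map f = (HomotopyCategory.quotient _ _).map f') :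
    e.chainPairing hK g f = e.chainPairing hK g' f' := by
  have h₁ := e.family_eq_zero_of_homotopy_left hK
    ((Homotopy.equivSubZero) (HomotopyCategory.homotopyOfEq _ _ hg)) f
  have h₂ := e.family_eq_zero_of_homotopy_right hK g'
    ((Homotopy.equivSubZero) (HomotopyCategory.homotopyOfEq _ _ hf))
  change e.chainPairing hK (g - g') f = 0 at h₁
  change e.chainPairing hK g' (f - f') = 0 at h₂
  rw [map_sub, LinearMap.sub_apply, sub_eq_zero] at h₁
  rw [map_sub, sub_eq_zero] at h₂
  rw [h₁, h₂]

/-- A chain map representing a morphism in `K^b`. -/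
def rep {X Y : Kb C} (f : X ⟶ Y) : X.obj.as ⟶ Y.obj.as := f.hom.out

lemma quotient_map_rep {X Y : Kb C} (f : X ⟶ Y) :
    (HomotopyCategory.quotient _ _).map (rep f) = f.hom :=
  HomotopyCategory.quotient_map_out _

/-- A chain map representing a morphism in `K^b` between termwise images. -/
def repMap {X Y : Kb C} (g : (mapKb F).obj Y ⟶ (mapKb G).obj X) :
    (F.mapHomologicalComplex (.up ℤ)).obj Y.obj.as ⟶
      (G.mapHomologicalComplex (.up ℤ)).obj X.obj.as := g.hom.out

lemma quotient_map_repMap {X Y : Kb C} (g : (mapKb F).obj Y ⟶ (mapKb G).obj X) :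
    (HomotopyCategory.quotient _ _).map (repMap g) = g.hom :=
  HomotopyCategory.quotient_map_out _

/-- The pairing on bounded homotopy categories induced by a pairing. -/
def kbPairing (X Y : Kb C) : ((mapKb F).obj Y ⟶ (mapKb G).obj X) →+ ((X ⟶ Y) →ₗ[R] E) where
  toFun g :=
    { toFun f := e.chainPairing (finite_support_of_bounded X) (repMap g) (rep f)
      map_add' f f' := by
        rw [← map_add]
        refine e.chainPairing_eq _ rfl ?_
        rw [Functor.map_add, quotient_map_rep, quotient_map_rep, quotient_map_rep]
        rfl
      map_smul' r f := by
        rw [← map_smul]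
        refine e.chainPairing_eq _ rfl ?_
        rw [Functor.map_smul, quotient_map_rep, quotient_map_rep]
        rfl }
  map_zero' := by
    ext f
    have h : e.chainPairing (finite_support_of_bounded X) (repMap 0) (rep f) =
        e.chainPairing (finite_support_of_bounded X) (0 : _ ⟶ _) (rep f) := by
      refine e.chainPairing_eq _ ?_ rfl
      rw [Functor.map_zero, quotient_map_repMap]
      rfl
    rw [map_zero] at h
    exact h
  map_add' g g' := by
    ext f
    have h : e.chainPairing (finite_support_of_bounded X) (repMap (g + g')) (rep f) =
        e.chainPairing (finite_support_of_bounded X) (repMap g + repMap g') (rep f) := by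
      refine e.chainPairing_eq _ ?_ rfl
      rw [Functor.map_add, quotient_map_repMap, quotient_map_repMap, quotient_map_repMap]
      rfl
    rw [map_add] at h
    exact h

lemma kbPairing_apply_eq {X Y : Kb C} (g : (mapKb F).obj Y ⟶ (mapKb G).obj X) (f : X ⟶ Y)
    (g' : (F.mapHomologicalComplex (.up ℤ)).obj Y.obj.as ⟶
      (G.mapHomologicalComplex (.up ℤ)).obj X.obj.as) (f' : X.obj.as ⟶ Y.obj.as)
    (hg : (HomotopyCategory.quotient _ _).map g' = g.hom)
    (hf : (HomotopyCategory.quotient _ _).map f' = f.hom) :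
    e.kbPairing X Y g f = e.chainPairing (finite_support_of_bounded X) g' f' :=
  e.chainPairing_eq _ ((quotient_map_repMap g).trans hg.symm)
    ((quotient_map_rep f).trans hf.symm)

lemma kbPairing_bijective [Module.Injective R E] (X Y : Kb C) :
    Function.Bijective (e.kbPairing X Y) := by
  constructor
  · rw [injective_iff_map_eq_zero]
    intro g hg
    obtain ⟨H⟩ := e.exists_homotopy_of_family_eq_zero (finite_support_of_bounded X) (repMap g)
      (fun f ↦ by
        have h := e.kbPairing_apply_eq g (ObjectProperty.homMk
          ((HomotopyCategory.quotient _ _).map f)) _ f (quotient_map_repMap g) rfl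
        rw [hg] at h
        exact h.symm)
    ext : 1
    rw [← quotient_map_repMap, HomotopyCategory.eq_of_homotopy _ _ H, Functor.map_zero]
    rfl
  · intro ψ
    obtain ⟨g, hg⟩ := e.exists_family_eq_of_homotopy (finite_support_of_bounded X)
      (K := X.obj.as) (L := Y.obj.as)
      { toFun f := ψ (ObjectProperty.homMk ((HomotopyCategory.quotient _ _).map f))
        map_add' f f' := by
          rw [Functor.map_add, ← map_add]
          rfl
        map_smul' r f := by
          rw [Functor.map_smul, RingHom.id_apply, ← map_smul]
          rfl }
      (fun f H ↦ by
        dsimp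
        rw [HomotopyCategory.eq_of_homotopy _ _ H, Functor.map_zero]
        exact map_zero ψ)
    refine ⟨ObjectProperty.homMk ((HomotopyCategory.quotient _ _).map g), ?_⟩
    ext f
    refine (e.kbPairing_apply_eq _ _ g (rep f) rfl (quotient_map_rep f)).trans
      ((hg (rep f)).trans (congrArg ψ ?_))
    ext : 1
    exact quotient_map_rep f

/-- The duality pairing on bounded homotopy categories induced by a duality pairing. -/
def kb [Module.Injective R E] : DualPairing R E (mapKb F) (mapKb G) where
  equiv X Y := AddEquiv.ofBijective (e.kbPairing X Y) (e.kbPairing_bijective X Y)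
  equiv_map_left {X Y Y'} b g f := by
    refine (e.kbPairing_apply_eq _ f ((F.mapHomologicalComplex _).map (rep b) ≫ repMap g) (rep f)
      ?_ (quotient_map_rep f)).trans (Eq.trans ?_ (e.kbPairing_apply_eq g (f ≫ b) (repMap g)
        (rep f ≫ rep b) (quotient_map_repMap g) ?_).symm)
    · rw [Functor.map_comp, quotient_map_repMap]
      change _ = (F.mapHomotopyCategory (.up ℤ)).map b.hom ≫ g.hom
      rw [← quotient_map_rep b]
      rfl
    · rw [chainPairing_apply, chainPairing_apply]
      refine finsum_congr fun p ↦ ?_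
      congr 1
      exact e.equiv_map_left ((rep b).f p) (components (repMap g) p) ((rep f).f p)
    · rw [Functor.map_comp, quotient_map_rep, quotient_map_rep]
      rfl
  equiv_map_right {X X' Y} a g f := by
    refine (e.kbPairing_apply_eq _ f (repMap g ≫ (G.mapHomologicalComplex _).map (rep a)) (rep f)
      ?_ (quotient_map_rep f)).trans (Eq.trans ?_ (e.kbPairing_apply_eq g (a ≫ f) (repMap g)
        (rep a ≫ rep f) (quotient_map_repMap g) ?_).symm)
    · rw [Functor.map_comp, quotient_map_repMap]
      change _ = g.hom ≫ (G.mapHomotopyCategory (.up ℤ)).map a.hom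
      rw [← quotient_map_rep a]
      rfl
    · rw [chainPairing_apply, chainPairing_apply]
      refine finsum_congr fun p ↦ ?_
      congr 1
      exact e.equiv_map_right ((rep a).f p) (components (repMap g) p) ((rep f).f p)
    · rw [Functor.map_comp, quotient_map_rep, quotient_map_rep]
      rfl

end Kb

section Transfer

variable {R : Type*} [CommRing R] {E : Type*} [AddCommGroup E] [Module R E]
    {T : Type*} [Category* T] [Preadditive T] [Linear R T]
    {T' : Type*} [Category* T'] [Preadditive T'] {T'' : Type*} [Category* T''] [Preadditive T'']
    {F F' G : T ⥤ T'}

/-- The image of a duality pairing by a functor which is bijective on the relevant morphisms. -/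
def comp (e : DualPairing R E F G) (Q : T' ⥤ T'') [Q.Additive]
    (hQ : ∀ X Y, Function.Bijective (Q.map : (F.obj Y ⟶ G.obj X) → _)) :
    DualPairing R E (F ⋙ Q) (G ⋙ Q) where
  equiv X Y := (AddEquiv.ofBijective (Q.mapAddHom (X := F.obj Y) (Y := G.obj X))
    (hQ X Y)).symm.trans (e.equiv X Y)
  equiv_map_left {X Y Y'} b g f := by
    obtain ⟨g, rfl⟩ := (AddEquiv.ofBijective (Q.mapAddHom) (hQ X Y')).surjective g
    refine Eq.trans ?_ ((e.equiv_map_left b g f).trans ?_)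
    · refine DFunLike.congr_fun (congrArg (e.equiv X Y) ?_) f
      exact (AddEquiv.symm_apply_eq _).2 (Q.map_comp _ _).symm
    · rw [AddEquiv.trans_apply, AddEquiv.symm_apply_apply]
  equiv_map_right {X X' Y} a g f := by
    obtain ⟨g, rfl⟩ := (AddEquiv.ofBijective (Q.mapAddHom) (hQ X Y)).surjective g
    refine Eq.trans ?_ ((e.equiv_map_right a g f).trans ?_)
    · refine DFunLike.congr_fun (congrArg (e.equiv X' Y) ?_) f
      exact (AddEquiv.symm_apply_eq _).2 (Q.map_comp _ _).symm
    · rw [AddEquiv.trans_apply, AddEquiv.symm_apply_apply]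

/-- Replacing the first functor of a duality pairing by an isomorphic one. -/
def ofIso (e : DualPairing R E F G) (α : F ≅ F') : DualPairing R E F' G where
  equiv X Y :=
    { toFun g := e.equiv X Y (α.hom.app Y ≫ g)
      invFun φ := α.inv.app Y ≫ (e.equiv X Y).symm φ
      left_inv g := by simp
      right_inv φ := by simp
      map_add' g g' := by simp }
  equiv_map_left b g f := by
    dsimp
    rw [← α.hom.naturality_assoc, e.equiv_map_left]
  equiv_map_right a g f := by
    dsimp
    rw [← Category.assoc, e.equiv_map_right]

end Transfer

section Serre

variable {R : Type u} [CommRing R] {E : Type v} [AddCommGroup E] [Module R E]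
    {T : Type w} [Category.{v} T] [Preadditive T] [Linear R T] {U : T ⥤ T}
    (e : DualPairing R E (𝟭 T) U)

/-- The bijections of a duality pairing with the identity functor are linear. -/
def linearEquiv (X Y : T) : (Y ⟶ U.obj X) ≃ₗ[R] ((X ⟶ Y) →ₗ[R] E) :=
  { e.equiv X Y with
    map_smul' r g := by
      ext f
      -- Scalars act through r • 𝟙 Y, so linearity is a case of naturality in Y; no linearity of U
      -- is needed.
      have h₁ : (r • 𝟙 Y) ≫ g = r • g := by simp
      have h₂ : f ≫ (r • 𝟙 Y) = r • f := by simp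
      refine (DFunLike.congr_fun (congrArg (e.equiv X Y) h₁.symm) f).trans
        ((e.equiv_map_left (r • 𝟙 Y) g f).trans ?_)
      rw [h₂, map_smul]
      rfl }

lemma linearEquiv_comp_left {X Y Y' : T} (b : Y ⟶ Y') (g : Y' ⟶ U.obj X) (f : X ⟶ Y) :
    e.linearEquiv X Y (b ≫ g) f = e.linearEquiv X Y' g (f ≫ b) :=
  e.equiv_map_left b g f

lemma linearEquiv_comp_right {X X' Y : T} (a : X ⟶ X') (g : Y ⟶ U.obj X) (f : X' ⟶ Y) :
    e.linearEquiv X' Y (g ≫ U.map a) f = e.linearEquiv X Y g (a ≫ f) :=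
  e.equiv_map_right a g f

lemma linearEquiv_symm_comp_left {X Y Y' : T} (b : Y ⟶ Y') (ψ : (X ⟶ Y') →ₗ[R] E)
    (ψ' : (X ⟶ Y) →ₗ[R] E) (h : ∀ f, ψ' f = ψ (f ≫ b)) :
    (e.linearEquiv X Y).symm ψ' = b ≫ (e.linearEquiv X Y').symm ψ := by
  rw [LinearEquiv.symm_apply_eq]
  ext f
  rw [linearEquiv_comp_left, LinearEquiv.apply_symm_apply, h]

lemma linearEquiv_symm_comp_right {X X' Y : T} (a : X ⟶ X') (ψ : (X ⟶ Y) →ₗ[R] E)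
    (ψ' : (X' ⟶ Y) →ₗ[R] E) (h : ∀ f, ψ' f = ψ (a ≫ f)) :
    (e.linearEquiv X' Y).symm ψ' = (e.linearEquiv X Y).symm ψ ≫ U.map a := by
  rw [LinearEquiv.symm_apply_eq]
  ext f
  rw [linearEquiv_comp_right, LinearEquiv.apply_symm_apply, h]

/-- Both sides are the form attached to the identity of U X, evaluated at f ≫ g. Thus U f
corresponds to evaluation at f. -/
lemma linearEquiv_map {X Y : T} (f : X ⟶ Y) (g : Y ⟶ U.obj X) :
    e.linearEquiv Y (U.obj X) (U.map f) g = e.linearEquiv X Y g f := by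
  have h₁ := e.linearEquiv_comp_right f (𝟙 _) g
  have h₂ := e.linearEquiv_comp_left g (𝟙 _) f
  rw [Category.id_comp] at h₁
  rw [Category.comp_id] at h₂
  rw [h₁, h₂]

include e in
-- By `linearEquiv_map`, the action of U on morphisms is identified with the map from Hom(X, Y) to
-- its double dual.
lemma map_bijective (hE : ∀ X Y : T, Function.Bijective
    (LinearMap.applyₗ : (X ⟶ Y) →ₗ[R] ((X ⟶ Y) →ₗ[R] E) →ₗ[R] E)) (X Y : T) :
    Function.Bijective (U.map : (X ⟶ Y) → _) := by
  constructor
  · intro f f' h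
    apply (hE X Y).1
    ext φ
    obtain ⟨g, rfl⟩ := (e.linearEquiv X Y).surjective φ
    change e.linearEquiv X Y g f = e.linearEquiv X Y g f'
    rw [← e.linearEquiv_map f g, ← e.linearEquiv_map f' g, h]
  · intro k
    obtain ⟨f, hf⟩ := (hE X Y).2 (e.linearEquiv Y (U.obj X) k ∘ₗ (e.linearEquiv X Y).symm)
    refine ⟨f, (e.linearEquiv Y (U.obj X)).injective ?_⟩
    ext g
    rw [linearEquiv_map]
    simpa using DFunLike.congr_fun hf (e.linearEquiv X Y g)

/-- A duality pairing with the identity functor gives the isomorphism of Serre duality. -/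
def serreIso : dualHom R E T ≅ U ⋙ linearYoneda R T :=
  NatIso.ofComponents (fun X ↦ NatIso.ofComponents
    (fun Y ↦ (ModuleCat.homLinearEquiv.trans (e.linearEquiv X Y.unop).symm).toModuleIso)
    (fun b ↦ by
      ext φ
      exact e.linearEquiv_symm_comp_left b.unop (ModuleCat.Hom.hom φ) _ fun f ↦ rfl))
    (fun a ↦ by
      ext Y φ
      exact e.linearEquiv_symm_comp_right a (ModuleCat.Hom.hom φ) _ fun f ↦ rfl)

end Serre

end DualPairing

/-! ### The functors `D Hom(M, -)` -/

lemma exact_of_exact_evaluation {J : Type*} [Category* J]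
    (S : ShortComplex (J ⥤ AddCommGrpCat.{v}))
    (h : ∀ j, (S.map ((evaluation J AddCommGrpCat.{v}).obj j)).Exact) : S.Exact := by
  rw [ShortComplex.exact_iff_isZero_homology, Functor.isZero_iff]
  intro j
  have hj := h j
  rw [ShortComplex.exact_iff_isZero_homology] at hj
  exact hj.of_iso (S.mapHomologyIso ((evaluation J AddCommGrpCat.{v}).obj j)).symm

section DualRepresentable

variable {C : Type u} [Category.{v} C] [Preadditive C]
  {R : Type*} [CommRing R] {E : Type v} [AddCommGroup E] [Module R E] [Linear R C]

/-- The linear form corresponding to an element of `D Hom(M, Z)`. -/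
def toForm {M : C} {Z : Cᵒᵖ} (x : ((dualRepresentable R E C).obj M).obj Z) :
    (M ⟶ Z.unop) →ₗ[R] E := ModuleCat.Hom.hom x

/-- The element of `D Hom(M, Z)` corresponding to a linear form. -/
def ofForm {M : C} {Z : Cᵒᵖ} (φ : (M ⟶ Z.unop) →ₗ[R] E) :
    ((dualRepresentable R E C).obj M).obj Z :=
  (ModuleCat.ofHom φ : ModuleCat.of R (M ⟶ Z.unop) ⟶ ModuleCat.of R E)

@[simp]
lemma toForm_ofForm {M : C} {Z : Cᵒᵖ} (φ : (M ⟶ Z.unop) →ₗ[R] E) :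
    toForm (ofForm φ) = φ := rfl

@[simp]
lemma ofForm_toForm {M : C} {Z : Cᵒᵖ} (x : ((dualRepresentable R E C).obj M).obj Z) :
    ofForm (toForm x) = x := rfl

lemma toForm_injective {M : C} {Z : Cᵒᵖ} :
    Function.Injective (toForm : ((dualRepresentable R E C).obj M).obj Z → _) :=
  fun x y h ↦ (ofForm_toForm x).symm.trans ((congrArg ofForm h).trans (ofForm_toForm y))

lemma toForm_map {M : C} {Z Z' : Cᵒᵖ} (b : Z ⟶ Z')
    (x : ((dualRepresentable R E C).obj M).obj Z) (f : M ⟶ Z'.unop) :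
    toForm (((dualRepresentable R E C).obj M).map b x) f = toForm x (f ≫ b.unop) := rfl

lemma toForm_app {M M' : C} {Z : Cᵒᵖ} (a : M ⟶ M')
    (x : ((dualRepresentable R E C).obj M).obj Z) (f : M' ⟶ Z.unop) :
    toForm (((dualRepresentable R E C).map a).app Z x) f = toForm x (a ≫ f) := rfl

lemma toForm_nat_app {M M' : C} (u : (dualRepresentable R E C).obj M ⟶
    (dualRepresentable R E C).obj M') {Z Z' : Cᵒᵖ} (b : Z ⟶ Z')
    (x : ((dualRepresentable R E C).obj M).obj Z) (f : M' ⟶ Z'.unop) :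
    toForm (u.app Z' (((dualRepresentable R E C).obj M).map b x)) f =
      toForm (u.app Z x) (f ≫ b.unop) := by
  have := ConcreteCategory.congr_hom (u.naturality b) x
  exact congrArg (fun y ↦ toForm y f) this

variable (R E) in
/-- The forms attached to a morphism from a representable functor to `D Hom(M, -)`. -/
def yonedaForm (M N : C) : (preadditiveYoneda.obj N ⟶ (dualRepresentable R E C).obj M) →+
    ((M ⟶ N) →ₗ[R] E) where
  toFun g := toForm (g.app (op N) (𝟙 N))
  map_zero' := rfl
  map_add' _ _ := rfl

lemma yonedaForm_apply {M N : C}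
    (g : preadditiveYoneda.obj N ⟶ (dualRepresentable R E C).obj M)
    {Z : Cᵒᵖ} (t : Z.unop ⟶ N) (f : M ⟶ Z.unop) :
    toForm (g.app Z t) f = yonedaForm R E M N g (f ≫ t) := by
  have h₁ := ConcreteCategory.congr_hom (g.naturality t.op) (𝟙 N)
  have h₂ : (preadditiveYoneda.obj N).map t.op (𝟙 N) = t := Category.comp_id t
  have h₃ : g.app Z t = ((dualRepresentable R E C).obj M).map t.op (g.app (op N) (𝟙 N)) :=
    (congrArg (g.app Z) h₂).symm.trans h₁
  exact congrArg (fun y ↦ toForm y f) h₃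

variable (R E) in
-- The Yoneda lemma: the inverse sends φ to the transformation t ↦ (f ↦ φ (f ≫ t)).
lemma yonedaForm_bijective (M N : C) : Function.Bijective (yonedaForm R E M N) := by
  constructor
  · intro g g' h
    ext Z (t : Z.unop ⟶ N)
    apply toForm_injective
    ext f
    rw [yonedaForm_apply, yonedaForm_apply, h]
  · intro φ
    refine ⟨{ app Z := AddCommGrpCat.ofHom
                { toFun (t : Z.unop ⟶ N) := ofForm (φ ∘ₗ Linear.rightComp R M t)
                  map_zero' := ?_
                  map_add' t t' := ?_ }
              naturality {Z Z'} b := ?_ }, ?_⟩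
    · apply toForm_injective
      ext f
      change φ (f ≫ (0 : Z.unop ⟶ N)) = 0
      rw [comp_zero, map_zero]
    · apply toForm_injective
      ext f
      exact (congrArg φ (Preadditive.comp_add _ _ _ f t t')).trans (map_add φ _ _)
    · ext (t : Z.unop ⟶ N)
      apply toForm_injective
      ext f
      change φ (f ≫ b.unop ≫ t) = φ ((f ≫ b.unop) ≫ t)
      rw [Category.assoc]
    · ext f
      change φ (f ≫ 𝟙 N) = φ f
      rw [Category.comp_id]

/-- The pairing between the Yoneda embedding and the functor `M ↦ D Hom(M, -)`. -/
def yonedaPairing [HasZeroObject C] (h : ∀ M : C, coherent C ((dualRepresentable R E C).obj M)) :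
    DualPairing R E (yonedaCoh C) (dualRepresentableCoh h) where
  equiv M N := AddEquiv.ofBijective
    ((yonedaForm R E M N).comp ((coherent C).ι.mapAddHom (X := (yonedaCoh C).obj N)
      (Y := (dualRepresentableCoh h).obj M)))
    ((yonedaForm_bijective R E M N).comp ((coherent C).fullyFaithfulι.map_bijective _ _))
  equiv_map_left {M N N'} b g f := by
    let g' : preadditiveYoneda.obj N' ⟶ (dualRepresentable R E C).obj M := g.hom
    change toForm (g'.app (op N) (𝟙 N ≫ b)) f = yonedaForm R E M N' g' (f ≫ b)
    exact (yonedaForm_apply g' (𝟙 N ≫ b) f).trans (by rw [Category.id_comp])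
  equiv_map_right {M M' N} a g f := rfl

variable (hE : ∀ X Y : C, Function.Bijective
    (LinearMap.applyₗ : (X ⟶ Y) →ₗ[R] ((X ⟶ Y) →ₗ[R] E) →ₗ[R] E))

include hE in
-- The transformation u gives the form φ ↦ u(φ)(𝟙) on D Hom(M, N); by reflexivity this is evaluation
-- at some a.
lemma dualRepresentable_map_surjective {M N : C}
    (u : (dualRepresentable R E C).obj M ⟶ (dualRepresentable R E C).obj N) :
    ∃ a : M ⟶ N, (dualRepresentable R E C).map a = u := by
  obtain ⟨a, ha⟩ := (hE M N).2
    { toFun φ := toForm (u.app (op N) (ofForm φ)) (𝟙 N)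
      map_add' φ φ' := by
        have : (ofForm (φ + φ') : ((dualRepresentable R E C).obj M).obj (op N)) =
          ofForm φ + ofForm φ' := rfl
        rw [this, map_add]
        rfl
      -- The values of u are only additive maps; R-linearity comes from naturality along r • 𝟙 N.
      map_smul' r φ := by
        have h : (ofForm (r • φ) : ((dualRepresentable R E C).obj M).obj (op N)) =
            ((dualRepresentable R E C).obj M).map (r • 𝟙 N).op (ofForm φ) := by
          apply toForm_injective
          ext f
          rw [toForm_map]
          simp
        rw [h, toForm_nat_app]
        simp }
  refine ⟨a, ?_⟩
  ext Z x
  apply toForm_injective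
  ext t
  have h := toForm_nat_app u (show op Z.unop ⟶ op N from t.op) x (𝟙 N)
  rw [toForm_app]
  refine Eq.trans ?_ (h.trans ?_)
  · exact DFunLike.congr_fun ha (toForm (((dualRepresentable R E C).obj M).map
      (show op Z.unop ⟶ op N from t.op) x))
  · exact congrArg _ (Category.id_comp t)

end DualRepresentable

/-! ### Coherence of D Hom(M, -) and coresolutions of representable functors -/

section Nakayama

variable {C : Type u} [Category.{v} C] [Abelian C]
  {R : Type*} [CommRing R] {E : Type v} [AddCommGroup E] [Module R E] [Linear R C]

/-- Hom(-, T) sends a right exact sequence to a left exact one, and D is exact because E is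
injective. -/
lemma dualRepresentable_exact [Module.Injective R E] {X Y Z : C} {a : X ⟶ Y} {b : Y ⟶ Z}
    {w : a ≫ b = 0} (h : (ShortComplex.mk a b w).Exact) [Epi b] :
    (ShortComplex.mk ((dualRepresentable R E C).map a) ((dualRepresentable R E C).map b)
      (by rw [← Functor.map_comp, w, Functor.map_zero])).Exact := by
  refine exact_of_exact_evaluation _ fun T ↦ ?_
  rw [ShortComplex.ab_exact_iff]
  intro (x : ((dualRepresentable R E C).obj Y).obj T) hx
  replace hx : ((dualRepresentable R E C).map b).app T x = 0 := hx
  obtain ⟨φ, hφ⟩ := exists_linearMap_extension (E := E) (Linear.leftComp R T.unop a) (toForm x) (by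
    intro (f : Y ⟶ T.unop) (hf : a ≫ f = 0)
    obtain ⟨g, rfl⟩ := (⟨_, h.g_desc f hf⟩ : ∃ g : Z ⟶ T.unop, b ≫ g = f)
    exact (toForm_app b x g).symm.trans (by rw [hx]; rfl))
  refine ⟨(ofForm φ : ((dualRepresentable R E C).obj X).obj T), ?_⟩
  apply toForm_injective (M := Y) (Z := T)
  ext f
  exact hφ f

instance dualRepresentable_epi [Module.Injective R E] {Y Z : C} (b : Y ⟶ Z) [Epi b] :
    Epi ((dualRepresentable R E C).map b) := by
  rw [NatTrans.epi_iff_epi_app]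
  intro T
  rw [AddCommGrpCat.epi_iff_surjective]
  intro (x : ((dualRepresentable R E C).obj Z).obj T)
  obtain ⟨φ, hφ⟩ := exists_linearMap_extension (E := E) (Linear.leftComp R T.unop b) (toForm x) (by
    intro (f : Z ⟶ T.unop) (hf : b ≫ f = 0)
    rw [show f = 0 by rw [← cancel_epi b, hf, comp_zero]]
    exact zero_mem _)
  refine ⟨(ofForm φ : ((dualRepresentable R E C).obj Y).obj T), ?_⟩
  apply toForm_injective (M := Z) (Z := T)
  ext f
  exact hφ f

variable (R E) in
/-- `I` represents the functor `D Hom(P, -)`. -/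
def IsNakayama (P I : C) : Prop :=
  Nonempty (preadditiveYoneda.obj I ≅ (dualRepresentable R E C).obj P)

variable [Module.Injective R E]
  (hproj : ∀ M : C, ∃ (P I : C) (p : P ⟶ M), Epi p ∧ IsNakayama R E P I)
  (hinj : ∀ M : C, ∃ (P I : C) (i : M ⟶ I), Mono i ∧ IsNakayama R E P I)
  (hE : ∀ X Y : C, Function.Bijective
    (LinearMap.applyₗ : (X ⟶ Y) →ₗ[R] ((X ⟶ Y) →ₗ[R] E) →ₗ[R] E))

include hproj in
-- A presentation P₁ → P₀ → M → 0 by objects from `hproj` becomes a presentation of D Hom(M, -)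
-- whose first two terms are represented by I₁ and I₀.
lemma coherent_dualRepresentable (M : C) : coherent C ((dualRepresentable R E C).obj M) := by
  obtain ⟨P₀, I₀, b, _, ⟨θ₀⟩⟩ := hproj M
  obtain ⟨P₁, I₁, q, _, ⟨θ₁⟩⟩ := hproj (kernel b)
  have w : (q ≫ kernel.ι b) ≫ b = 0 := by simp
  have hex : (ShortComplex.mk (q ≫ kernel.ι b) b w).Exact := by
    let φ : ShortComplex.mk (q ≫ kernel.ι b) b w ⟶
        ShortComplex.mk (kernel.ι b) b (kernel.condition b) :=
      { τ₁ := q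
        τ₂ := 𝟙 _
        τ₃ := 𝟙 _ }
    have : Epi φ.τ₁ := inferInstanceAs (Epi q)
    have : IsIso φ.τ₂ := inferInstanceAs (IsIso (𝟙 P₀))
    have : Mono φ.τ₃ := inferInstanceAs (Mono (𝟙 M))
    exact (ShortComplex.exact_iff_of_epi_of_isIso_of_mono φ).2
      (ShortComplex.exact_of_f_is_kernel _ (kernelIsKernel b))
  have hν := dualRepresentable_exact (R := R) (E := E) hex
  let f := preadditiveYoneda.preimage (θ₁.hom ≫
    (dualRepresentable R E C).map (q ≫ kernel.ι b) ≫ θ₀.inv)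
  have hf : preadditiveYoneda.map f = θ₁.hom ≫
    (dualRepresentable R E C).map (q ≫ kernel.ι b) ≫ θ₀.inv := Functor.map_preimage _ _
  have zero : preadditiveYoneda.map f ≫ θ₀.hom ≫ (dualRepresentable R E C).map b = 0 := by
    rw [hf, Category.assoc, Category.assoc, Iso.inv_hom_id_assoc, ← Functor.map_comp, w,
      Functor.map_zero, comp_zero]
  refine ⟨I₁, I₀, f, θ₀.hom ≫ (dualRepresentable R E C).map b, zero, ?_, inferInstance⟩
  refine ShortComplex.exact_of_iso ?_ hν
  exact ShortComplex.isoMk θ₁.symm θ₀.symm (Iso.refl _) (by simp [hf]) (by simp)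

variable (h : ∀ M : C, coherent C ((dualRepresentable R E C).obj M))

include hinj hE in
-- Take a copresentation 0 → M → I₀ → I₁ with Hom(-, Iₖ) ≅ D Hom(Pₖ, -). The map between the duals
-- comes from some a : P₀ ⟶ P₁, and right exactness of M ↦ D Hom(M, -) continues the sequence with T
-- = coker a.
lemma exists_dualRepresentable_coresolution (M : C) : ∃ (P₀ P₁ T : C)
    (f : (yonedaCoh C).obj M ⟶ (dualRepresentableCoh h).obj P₀) (a : P₀ ⟶ P₁) (b : P₁ ⟶ T)
    (w₁ : f ≫ (dualRepresentableCoh h).map a = 0)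
    (w₂ : (dualRepresentableCoh h).map a ≫ (dualRepresentableCoh h).map b = 0),
    Mono f ∧ Epi ((dualRepresentableCoh h).map b) ∧ (ShortComplex.mk _ _ w₁).Exact ∧
    (ShortComplex.mk _ _ w₂).Exact := by
  obtain ⟨P₀, I₀, i, _, ⟨θ₀⟩⟩ := hinj M
  obtain ⟨P₁, I₁, j, _, ⟨θ₁⟩⟩ := hinj (cokernel i)
  have w : i ≫ cokernel.π i ≫ j = 0 := by simp
  let hk : IsLimit (KernelFork.ofι i w) :=
    isKernelCompMono (Abelian.monoIsKernelOfCokernel _ (cokernelIsCokernel i)) j rfl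
  have w' : preadditiveYoneda.map i ≫ preadditiveYoneda.map (cokernel.π i ≫ j) = 0 := by
    rw [← Functor.map_comp, w, Functor.map_zero]
  let hk' := KernelFork.mapIsLimit _ hk preadditiveYoneda
  have hex : (ShortComplex.mk _ _ w').Exact := ShortComplex.exact_of_f_is_kernel _ hk'
  have hmono : Mono (preadditiveYoneda.map i) := Fork.IsLimit.mono hk'
  obtain ⟨a, ha⟩ := dualRepresentable_map_surjective hE
    (θ₀.inv ≫ preadditiveYoneda.map (cokernel.π i ≫ j) ≫ θ₁.hom)
  have z₁ : (preadditiveYoneda.map i ≫ θ₀.hom) ≫ (dualRepresentable R E C).map a = 0 := by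
    rw [ha, Category.assoc, Iso.hom_inv_id_assoc, reassoc_of% w', zero_comp]
  have z₂ : (dualRepresentableCoh h).map a ≫ (dualRepresentableCoh h).map (cokernel.π a) = 0 := by
    rw [← Functor.map_comp, cokernel.condition, Functor.map_zero]
  refine ⟨P₀, P₁, cokernel a, ObjectProperty.homMk (preadditiveYoneda.map i ≫ θ₀.hom), a,
    cokernel.π a, by ext : 1; exact z₁, z₂, ?_, ?_, ?_, ?_⟩
  · exact (coherent C).ι.mono_of_mono_map
      (inferInstanceAs (Mono (preadditiveYoneda.map i ≫ θ₀.hom)))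
  · rw [coh_epi_iff]
    exact inferInstanceAs (Epi ((dualRepresentable R E C).map (cokernel.π a)))
  · rw [← coh_exact_iff]
    have hz : (ShortComplex.mk _ _ z₁).Exact := by
      refine ShortComplex.exact_of_iso ?_ hex
      exact ShortComplex.isoMk (Iso.refl _) θ₀ θ₁ (by simp) (by simp [ha])
    exact hz
  · rw [← coh_exact_iff]
    exact dualRepresentable_exact (ShortComplex.exact_of_g_is_cokernel
      (.mk a (cokernel.π a) (cokernel.condition a)) (cokernelIsCokernel a))

variable [HasDerivedCategory.{w} (Coh C)]

instance : (dualRepresentableDb h).CommShift ℤ :=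
  inferInstanceAs ((mapKb (dualRepresentableCoh h) ⋙ localizationKb (Coh C)).CommShift ℤ)

instance : (dualRepresentableDb h).IsTriangulated :=
  inferInstanceAs (mapKb (dualRepresentableCoh h) ⋙ localizationKb (Coh C)).IsTriangulated

include hinj hE in
lemma dualRepresentableDb_essSurj [(dualRepresentableDb h).Full]
    [(dualRepresentableDb h).Faithful] : (dualRepresentableDb h).EssSurj := by
  let P := (dualRepresentableDb h ⋙
    (DerivedCategory.TStructure.t (C := Coh C)).bounded.ι).essImage
  have hν (M : C) : heartProperty P ((dualRepresentableCoh h).obj M) :=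
    ⟨singleKb M, ⟨mapKbLocalizationSingleIso (dualRepresentableCoh h) M⟩⟩
  have hy (M : C) : heartProperty P ((yonedaCoh C).obj M) := by
    obtain ⟨P₀, P₁, T, f, a, b, w₁, w₂, _, _, h₁, h₂⟩ :=
      exists_dualRepresentable_coresolution hinj hE h M
    exact heartProperty_left _ h₁ h₂ (hν _) (hν _) (hν _)
  refine essSurj_of_heartProperty _ (fun F ↦ ?_)
  obtain ⟨X, Y, f, p, zero, zero', h₁, h₂, _, _⟩ := exists_yonedaCoh_resolution F
  exact heartProperty_right _ h₁ h₂ (hy _) (hy _) (hy _)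

end Nakayama

/-! ### Finiteness of morphism modules in K^b -/

section HomFinite

variable {R : Type*} [CommRing R] {C : Type*} [Category.{v} C] [Preadditive C] [Linear R C]

lemma finite_hom_of_bounded [IsNoetherianRing R] (hC : IsHomFinite R C) {K L : CochainComplex C ℤ}
    (hK : {p | ¬ IsZero (K.X p)}.Finite) : Module.Finite R (K ⟶ L) := by
  have := hK.to_subtype
  have := fun p : {p | ¬ IsZero (K.X p)} ↦ hC (K.X p) (L.X p)
  let f : (K ⟶ L) →ₗ[R] (∀ p : {p | ¬ IsZero (K.X p)}, K.X p ⟶ L.X p) :=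
    { toFun φ p := φ.f p
      map_add' _ _ := rfl
      map_smul' _ _ := rfl }
  refine Module.Finite.of_injective f fun φ ψ h ↦ ?_
  ext p
  by_cases hp : IsZero (K.X p)
  · exact hp.eq_of_src _ _
  · exact congrFun h ⟨p, hp⟩

/-- The linear map from chain maps to morphisms in `K^b`. -/
def chainMapToKb (R : Type*) [CommRing R] [Linear R C] (X Y : Kb C) :
    (X.obj.as ⟶ Y.obj.as) →ₗ[R] (X ⟶ Y) where
  toFun f := ObjectProperty.homMk ((HomotopyCategory.quotient _ _).map f)
  map_add' f g := by
    rw [Functor.map_add]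
    rfl
  map_smul' r f := by
    rw [Functor.map_smul]
    rfl

lemma chainMapToKb_surjective (X Y : Kb C) : Function.Surjective (chainMapToKb R X Y) :=
  fun f ↦ ⟨DualPairing.rep f, by ext : 1; exact DualPairing.quotient_map_rep f⟩

lemma isHomFinite_Kb [IsNoetherianRing R] (hC : IsHomFinite R C) : IsHomFinite R (Kb C) := fun X Y ↦
  have := finite_hom_of_bounded hC (finite_support_of_bounded X) (L := Y.obj.as)
  Module.Finite.of_surjective _ (chainMapToKb_surjective (R := R) X Y)

end HomFinite

/-! ### The Serre functor -/

section SerreDuality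

variable {C : Type u} [Category.{v} C] [Abelian C]
  {R : Type w} [CommRing R] [IsNoetherianRing R] {E : Type v} [AddCommGroup E] [Module R E]
  [Linear R C] [Module.Injective R E]
  (hC : IsHomFinite R C)
  (hproj : ∀ M : C, ∃ (P I : C) (p : P ⟶ M), Epi p ∧ IsNakayama R E P I)
  (hinj : ∀ M : C, ∃ (P I : C) (i : M ⟶ I), Mono i ∧ IsNakayama R E P I)
  (hE : ∀ (M : Type v) [AddCommGroup M] [Module R M] [Module.Finite R M], Function.Bijective
    (LinearMap.applyₗ : M →ₗ[R] (M →ₗ[R] E) →ₗ[R] E))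
  [HasDerivedCategory (Coh C)]

include hC hproj hinj hE in
theorem exists_serreFunctor :
    ∃ (h : ∀ M : C, coherent C ((dualRepresentable R E C).obj M))
      (V : Db (Coh C) ⥤ Db (Coh C)) (U : Kb C ⥤ Kb C),
      IsTriangleEquivalence V ∧
      Nonempty (yonedaDb C ⋙ V ≅ dualRepresentableDb h) ∧
      IsTriangleEquivalence U ∧
      IsSerreFunctor R E U ∧
      Nonempty (U ⋙ yonedaDb C ≅ yonedaDb C ⋙ V) := by
  have h := coherent_dualRepresentable (R := R) (E := E) hproj
  have hQ := isTriangleEquivalence_yonedaDb C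
  have : (yonedaDb C).IsEquivalence := hQ.1
  have : (yonedaDb C).asEquivalence.functor.Additive := by
    change (mapKb (yonedaCoh C) ⋙ localizationKb (Coh C)).Additive
    infer_instance
  let Q := (yonedaDb C).asEquivalence
  have hQ' : IsTriangleEquivalence Q.inverse := IsTriangleEquivalence.symm (e := Q) hQ
  have : Q.inverse.Additive := Equivalence.inverse_additive Q
  let N := dualRepresentableDb h
  -- The pairing passes from C to K^b, then to D^b, then back along Q⁻¹, where Q⁻¹Q is replaced by
  -- the identity. Nothing is yet known about N being an equivalence.
  let e : DualPairing R E (𝟭 (Kb C)) (N ⋙ Q.inverse) :=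
    (((yonedaPairing h).kb.comp (localizationKb (Coh C))
      (fun X Y ↦ localizationKb_map_bijective Y _)).comp Q.inverse
        (fun X Y ↦ (Functor.FullyFaithful.ofFullyFaithful Q.inverse).map_bijective _ _)).ofIso
          Q.unitIso.symm
  have hE' (X Y : Kb C) := have := isHomFinite_Kb hC X Y; hE (X ⟶ Y)
  -- The pairing and reflexivity make Q⁻¹N bijective on morphisms, and Q⁻¹ can be cancelled.
  have hN (X Y : Kb C) : Function.Bijective (N.map : (X ⟶ Y) → _) :=
    (Function.Bijective.of_comp_iff'
      ((Functor.FullyFaithful.ofFullyFaithful Q.inverse).map_bijective _ _) _).1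
        (e.map_bijective hE' X Y)
  have : (dualRepresentableDb h).Full := ⟨(hN _ _).2⟩
  have : (dualRepresentableDb h).Faithful := ⟨fun {_ _ _ _} h ↦ (hN _ _).1 h⟩
  have : (dualRepresentableDb h).EssSurj :=
    dualRepresentableDb_essSurj hinj (fun X Y ↦ have := hC X Y; hE (X ⟶ Y)) h
  have hN' : IsTriangleEquivalence N := ⟨{ }, inferInstance, inferInstance⟩
  have hU := hN'.comp hQ'
  refine ⟨h, Q.inverse ⋙ N, N ⋙ Q.inverse, hQ'.comp hN', ⟨?_⟩, hU, ⟨hU.1, ⟨e.serreIso⟩⟩, ⟨?_⟩⟩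
  · exact Functor.isoWhiskerRight Q.unitIso.symm N ≪≫ N.leftUnitor
  · exact Functor.isoWhiskerLeft N Q.counitIso ≪≫ N.rightUnitor ≪≫
      N.leftUnitor.symm ≪≫ Functor.isoWhiskerRight Q.unitIso N

end SerreDuality

/-! ### Local rings and idempotents -/

section LocalRings

/-- An algebra that is finite over an artinian ring and has only the idempotents `0` and `1` is
local. -/
lemma isLocalRing_of_isIdempotentElem (R : Type*) {A : Type*} [CommRing R] [IsArtinianRing R]
    [Ring A] [Algebra R A] [Module.Finite R A] [Nontrivial A]
    (hA : ∀ e : A, IsIdempotentElem e → e = 0 ∨ e = 1) : IsLocalRing A := by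
  refine IsLocalRing.of_isUnit_or_isUnit_one_sub_self fun a ↦ ?_
  -- Fitting's lemma for left multiplication by a. The exponent n + 1 is positive, so that a unit
  -- power makes a itself a unit.
  obtain ⟨n, hn⟩ := (LinearMap.eventually_isCompl_ker_pow_range_pow
    (LinearMap.mulLeft R a)).exists_forall_of_atTop
  replace hn := hn (n + 1) (by lia)
  rw [LinearMap.pow_mulLeft] at hn
  -- The component f of 1 in the image is idempotent. If f = 0 then a is nilpotent; if f = 1 then a
  -- power of a is invertible.
  obtain ⟨e, he, f, hf, hef⟩ := Submodule.mem_sup.1 (hn.sup_eq_top ▸ Submodule.mem_top (x := (1 : A)))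
  obtain ⟨b, hb⟩ := hf
  rw [LinearMap.mem_ker, LinearMap.mulLeft_apply] at he
  rw [LinearMap.mulLeft_apply] at hb
  have hzero (x : A) (h₁ : a ^ (n + 1) * x = 0) (h₂ : ∃ y, a ^ (n + 1) * y = x) : x = 0 := by
    have := hn.inf_eq_bot.le ⟨LinearMap.mem_ker.2 (by simpa using h₁), (by simpa using h₂)⟩
    exact (Submodule.mem_bot R).1 this
  have hfe : e * f = 0 := hzero _ (by rw [← mul_assoc, he, zero_mul]) ⟨b - b * f, by
    rw [mul_sub, ← mul_assoc, hb, sub_eq_iff_eq_add, ← add_mul, hef, one_mul]⟩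
  have hff : IsIdempotentElem f := by
    have := congrArg (· * f) hef
    rwa [add_mul, hfe, zero_add, one_mul] at this
  obtain rfl | rfl := hA f hff
  · rw [add_zero] at hef
    rw [hef, mul_one] at he
    exact Or.inr (IsNilpotent.isUnit_one_sub ⟨_, he⟩)
  · have hba : b * a ^ (n + 1) = 1 := by
      rw [← sub_eq_zero]
      refine hzero _ (by rw [mul_sub, ← mul_assoc, hb, one_mul, mul_one, sub_self])
        ⟨b * (b * a ^ (n + 1) - 1), ?_⟩
      rw [← mul_assoc, hb, one_mul]
    have : IsUnit (a ^ (n + 1)) := ⟨⟨_, _, hb, hba⟩, rfl⟩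
    exact Or.inl ((isUnit_pow_succ_iff).1 this)

lemma isLocalRing_of_surjective {A B : Type*} [Ring A] [Ring B] [IsLocalRing A] [Nontrivial B]
    (f : A →+* B) (hf : Function.Surjective f) : IsLocalRing B := by
  refine IsLocalRing.of_isUnit_or_isUnit_one_sub_self fun b ↦ ?_
  obtain ⟨a, rfl⟩ := hf b
  obtain h | h := IsLocalRing.isUnit_or_isUnit_of_add_one (add_sub_cancel a 1)
  · exact Or.inl (h.map f)
  · exact Or.inr (by simpa using h.map f)

end LocalRings

/-! ### Decompositions into objects with local endomorphism rings -/

section Decomposition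

variable {T : Type*} [Category* T] [Preadditive T]

/-- A finite direct sum decomposition of `X` into objects with local endomorphism rings. -/
structure LocalDecomposition (X : T) where
  /-- the index type -/
  J : Type
  [fintype : Fintype J]
  /-- the summands -/
  obj : J → T
  /-- the inclusions -/
  ι (j : J) : obj j ⟶ X
  /-- the projections -/
  π (j : J) : X ⟶ obj j
  ι_π (j : J) : ι j ≫ π j = 𝟙 _
  ι_π_of_ne (j k : J) : j ≠ k → ι j ≫ π k = 0
  total : ∑ j, π j ≫ ι j = 𝟙 X
  isLocalRing (j : J) : IsLocalRing (End (obj j))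

namespace LocalDecomposition

attribute [instance] fintype

/-- The empty decomposition of a zero object. -/
def empty {X : T} (hX : 𝟙 X = 0) : LocalDecomposition X where
  J := Empty
  obj j := j.elim
  ι j := j.elim
  π j := j.elim
  ι_π j := j.elim
  ι_π_of_ne j := j.elim
  total := by simp [hX]
  isLocalRing j := j.elim

/-- The decomposition with one summand. -/
def single (X : T) [IsLocalRing (End X)] : LocalDecomposition X where
  J := Unit
  obj _ := X
  ι _ := 𝟙 X
  π _ := 𝟙 X
  ι_π _ := Category.comp_id _
  ι_π_of_ne _ _ h := (h rfl).elim
  total := by simp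
  isLocalRing _ := inferInstance

/-- Decompositions of two complementary summands give a decomposition of their sum. -/
def sum {X Y Z : T} {i : Y ⟶ X} {p : X ⟶ Y} {j : Z ⟶ X} {q : X ⟶ Z} (hip : i ≫ p = 𝟙 Y)
    (hjq : j ≫ q = 𝟙 Z) (h : p ≫ i + q ≫ j = 𝟙 X) (DY : LocalDecomposition Y)
    (DZ : LocalDecomposition Z) : LocalDecomposition X :=
  have hiq : i ≫ q = 0 := by
    have := i ≫= h =≫ q
    simpa [reassoc_of% hip, hjq] using this
  have hjp : j ≫ p = 0 := by
    have := j ≫= h =≫ p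
    simpa [reassoc_of% hjq, hip] using this
  { J := DY.J ⊕ DZ.J
    obj := Sum.elim DY.obj DZ.obj
    ι := fun
      | .inl k => DY.ι k ≫ i
      | .inr k => DZ.ι k ≫ j
    π := fun
      | .inl k => p ≫ DY.π k
      | .inr k => q ≫ DZ.π k
    ι_π := by
      rintro (k | k)
      · simpa [reassoc_of% hip] using DY.ι_π k
      · simpa [reassoc_of% hjq] using DZ.ι_π k
    ι_π_of_ne := by
      rintro (k | k) (l | l) hkl
      · refine Eq.trans ?_ (DY.ι_π_of_ne k l fun h' ↦ hkl (congrArg _ h'))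
        simp [reassoc_of% hip]
      · change (DY.ι k ≫ i) ≫ q ≫ DZ.π l = 0
        rw [Category.assoc, reassoc_of% hiq, zero_comp, comp_zero]
      · change (DZ.ι k ≫ j) ≫ p ≫ DY.π l = 0
        rw [Category.assoc, reassoc_of% hjp, zero_comp, comp_zero]
      · refine Eq.trans ?_ (DZ.ι_π_of_ne k l fun h' ↦ hkl (congrArg _ h'))
        simp [reassoc_of% hjq]
    total := by
      have hY : ∑ k, (p ≫ DY.π k) ≫ DY.ι k ≫ i = p ≫ i := by
        simpa [Preadditive.comp_sum, Preadditive.sum_comp] using p ≫= DY.total =≫ i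
      have hZ : ∑ k, (q ≫ DZ.π k) ≫ DZ.ι k ≫ j = q ≫ j := by
        simpa [Preadditive.comp_sum, Preadditive.sum_comp] using q ≫= DZ.total =≫ j
      rw [Fintype.sum_sum_type, ← h, ← hY, ← hZ]
      rfl
    isLocalRing := by
      rintro (k | k)
      · exact DY.isLocalRing k
      · exact DZ.isLocalRing k }

/-- The image of a decomposition under a full additive functor. -/
def map {T' : Type*} [Category* T'] [Preadditive T'] {X : T} (D : LocalDecomposition X)
    (G : T ⥤ T') [G.Additive] [G.Full] : LocalDecomposition (G.obj X) := by
  classical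
  exact
  -- Summands killed by G are dropped, since the zero ring is not local. The other endomorphism
  -- rings are quotients of local rings because G is full.
  { J := {j : D.J // 𝟙 (G.obj (D.obj j)) ≠ 0}
    obj j := G.obj (D.obj j)
    ι j := G.map (D.ι j)
    π j := G.map (D.π j)
    ι_π j := by rw [← G.map_comp, D.ι_π, G.map_id]
    ι_π_of_ne j k h := by
      rw [← G.map_comp, D.ι_π_of_ne _ _ (fun h' ↦ h (Subtype.ext h')), G.map_zero]
    total := by
      rw [← G.map_id, ← D.total, G.map_sum]
      simp only [G.map_comp]
      rw [← Finset.sum_subtype {j | 𝟙 (G.obj (D.obj j)) ≠ 0} (by simp)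
        fun j ↦ G.map (D.π j) ≫ G.map (D.ι j)]
      refine Finset.sum_filter_of_ne fun j _ h h' ↦ h ?_
      rw [← Category.id_comp (G.map (D.ι j)), h', zero_comp, comp_zero]
    isLocalRing j := by
      have := D.isLocalRing j
      have : Nontrivial (End (G.obj (D.obj j))) := ⟨_, _, j.2⟩
      let f : End (D.obj j) →+* End (G.obj (D.obj j)) :=
        { G.mapEnd (D.obj j) with
          map_zero' := G.map_zero _ _
          map_add' _ _ := G.map_add }
      exact isLocalRing_of_surjective f G.map_surjective }

end LocalDecomposition

lemma isKrullSchmidt_of_localDecomposition (h : ∀ X : T, Nonempty (LocalDecomposition X)) :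
    IsKrullSchmidt T := fun X ↦ by
  obtain ⟨D⟩ := h X
  let e := Fintype.equivFin D.J
  let b : Bicone (fun k ↦ D.obj (e.symm k)) :=
    { pt := X
      π k := D.π _
      ι k := D.ι _
      ι_π k l := by
        split_ifs with hkl
        · subst hkl
          exact D.ι_π _
        · exact D.ι_π_of_ne _ _ (fun h' ↦ hkl (e.symm.injective h')) }
  refine ⟨_, _, b, ⟨isBilimitOfTotal b ?_⟩, ⟨Iso.refl X⟩, fun k ↦ D.isLocalRing _⟩
  exact (e.symm.sum_comp fun j ↦ D.π j ≫ D.ι j).trans D.total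

/-- In an idempotent complete category over an artinian ring, an object whose endomorphisms form
a finite module is a finite direct sum of objects with local endomorphism rings. -/
theorem nonempty_localDecomposition (R : Type*) [CommRing R] [IsArtinianRing R] [Linear R T]
    [IsIdempotentComplete T] (X : T) [Module.Finite R (X ⟶ X)] :
    Nonempty (LocalDecomposition X) := by
  induction hl : Module.length R (X ⟶ X) using WellFoundedLT.induction generalizing X with
  | ind l ih =>
  subst hl
  by_cases hX : 𝟙 X = 0
  · exact ⟨.empty hX⟩
  by_cases hI : ∀ e : X ⟶ X, e ≫ e = e → e = 0 ∨ e = 𝟙 X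
  · have : Nontrivial (End X) := ⟨_, _, hX⟩
    have : Module.Finite R (End X) := inferInstanceAs (Module.Finite R (X ⟶ X))
    have : IsLocalRing (End X) := isLocalRing_of_isIdempotentElem R hI
    exact ⟨.single X⟩
  push Not at hI
  obtain ⟨e, he, he₀, he₁⟩ := hI
  have key (f : X ⟶ X) (hf : f ≫ f = f) (hf₁ : f ≠ 𝟙 X) : ∃ (Y : T) (i : Y ⟶ X) (p : X ⟶ Y),
      i ≫ p = 𝟙 Y ∧ p ≫ i = f ∧ Nonempty (LocalDecomposition Y) := by
    obtain ⟨Y, i, p, hip, hpi⟩ := IsIdempotentComplete.idempotents_split X f hf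
    let F : (Y ⟶ Y) →ₗ[R] (X ⟶ X) := Linear.rightComp R X i ∘ₗ Linear.leftComp R Y p
    have hF (φ : Y ⟶ Y) : F φ = p ≫ φ ≫ i := Category.assoc _ _ _
    have hFi : Function.Injective F := fun φ ψ h ↦ by
      rw [hF, hF] at h
      simpa [reassoc_of% hip, hip] using i ≫= h =≫ p
    have : Module.Finite R (Y ⟶ Y) := Module.Finite.of_injective F hFi
    -- Everything in the range of F is fixed by f on the left, while f kills 𝟙 X - f ≠ 0. Hence End
    -- Y has smaller length than End X and the induction applies.
    have hr : LinearMap.range F ≠ ⊤ := fun hr ↦ by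
      obtain ⟨φ, hφ⟩ := LinearMap.range_eq_top.1 hr (𝟙 X - f)
      rw [hF] at hφ
      have h₁ : p ≫ φ ≫ i = f ≫ (p ≫ φ ≫ i) := by simp [← hpi, reassoc_of% hip]
      rw [hφ, Preadditive.comp_sub, Category.comp_id, hf, sub_self, sub_eq_zero] at h₁
      exact hf₁ h₁.symm
    refine ⟨Y, i, p, hip, hpi, ih _ ?_ Y rfl⟩
    rw [(LinearEquiv.ofInjective F hFi).length_eq]
    exact Submodule.length_lt hr
  obtain ⟨Y, i, p, hip, hpi, ⟨DY⟩⟩ := key e he he₁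
  obtain ⟨Z, j, q, hjq, hqj, ⟨DZ⟩⟩ := key (𝟙 X - e) (by simp [he]) (by simpa using he₀)
  exact ⟨.sum hip hjq (by rw [hpi, hqj, add_sub_cancel]) DY DZ⟩

end Decomposition

/-! ### The Krull-Schmidt property of K^b -/

section KrullSchmidt

variable (C : Type u) [Category.{v} C]

/-- The bounded cochain complexes. -/
def boundedComplexes [Preadditive C] : ObjectProperty (CochainComplex C ℤ) :=
  (bounded C).inverseImage (HomotopyCategory.quotient C (ComplexShape.up ℤ))

/-- The functor from bounded complexes to `K^b`. -/
def quotientKb [Preadditive C] : (boundedComplexes C).FullSubcategory ⥤ Kb C :=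
  (bounded C).lift ((boundedComplexes C).ι ⋙ HomotopyCategory.quotient C (ComplexShape.up ℤ))
    fun K ↦ K.property

instance [Preadditive C] : (quotientKb C).Additive where
  map_add := by
    intros
    ext : 1
    exact (HomotopyCategory.quotient C (ComplexShape.up ℤ)).map_add

instance [Preadditive C] : (quotientKb C).Full where
  map_surjective {X Y} f := by
    obtain ⟨g, hg⟩ := (HomotopyCategory.quotient C (ComplexShape.up ℤ)).map_surjective f.hom
    exact ⟨ObjectProperty.homMk g, by ext : 1; exact hg⟩

lemma boundedComplexes_of_retract [Preadditive C] {K L : CochainComplex C ℤ} (i : K ⟶ L)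
    (p : L ⟶ K) (hip : i ≫ p = 𝟙 K) (hL : boundedComplexes C L) : boundedComplexes C K := by
  have hz (n : ℤ) (hn : IsZero (L.X n)) : IsZero (K.X n) := by
    rw [IsZero.iff_id_eq_zero, ← HomologicalComplex.id_f, ← hip, HomologicalComplex.comp_f,
      hn.eq_of_tgt (i.f n) 0, zero_comp]
  obtain ⟨⟨a, ha⟩, ⟨b, hb⟩⟩ := hL
  change L.IsStrictlyGE a at ha
  change L.IsStrictlyLE b at hb
  refine ⟨⟨a, ?_⟩, ⟨b, ?_⟩⟩
  · exact (CochainComplex.isStrictlyGE_iff K a).2 fun n hn ↦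
      hz n (L.isZero_of_isStrictlyGE a n hn)
  · exact (CochainComplex.isStrictlyLE_iff K b).2 fun n hn ↦
      hz n (L.isZero_of_isStrictlyLE b n hn)

instance [Abelian C] : IsIdempotentComplete (boundedComplexes C).FullSubcategory where
  idempotents_split K e he := by
    obtain ⟨L, i, p, hip, hpi⟩ :=
      (Idempotents.isIdempotentComplete_of_abelian (CochainComplex C ℤ)).idempotents_split
        K.obj e.hom (congrArg InducedCategory.Hom.hom he)
    exact ⟨⟨L, boundedComplexes_of_retract C i p hip K.property⟩, ObjectProperty.homMk i,
      ObjectProperty.homMk p, by ext : 1; exact hip, by ext : 1; exact hpi⟩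

variable {C}

/-- The decomposition is made among bounded complexes, so no splitting of idempotents in K^b is
required. -/
theorem isKrullSchmidt_Kb [Abelian C] {R : Type*} [CommRing R] [IsArtinianRing R] [Linear R C]
    (hC : IsHomFinite R C) : IsKrullSchmidt (Kb C) := by
  refine isKrullSchmidt_of_localDecomposition fun X ↦ ?_
  let K : (boundedComplexes C).FullSubcategory := ⟨X.obj.as, X.property⟩
  have := finite_hom_of_bounded hC (finite_support_of_bounded X) (L := X.obj.as)
  have : Module.Finite R (K ⟶ K) := by
    let f : (K ⟶ K) →ₗ[R] (K.obj ⟶ K.obj) :=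
      { toFun φ := φ.hom
        map_add' _ _ := rfl
        map_smul' _ _ := rfl }
    exact Module.Finite.of_injective f fun _ _ h ↦ ObjectProperty.hom_ext _ h
  obtain ⟨D⟩ := nonempty_localDecomposition R K
  exact ⟨D.map (quotientKb C)⟩

end KrullSchmidt

/-! ### Duality for finitely generated modules over an artinian ring -/

section ArtinDuality

variable {R : Type u} [CommRing R]

lemma exists_notMem_of_isMaximal [IsArtinianRing R] (m : MaximalSpectrum R) :
    ∃ a ∉ m.asIdeal, ∀ m' : MaximalSpectrum R, m' ≠ m → a ∈ m'.asIdeal := by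
  classical
  have := Fintype.ofFinite (MaximalSpectrum R)
  have h : ¬ (Finset.univ.erase m).inf MaximalSpectrum.asIdeal ≤ m.asIdeal := by
    rw [Ideal.IsPrime.inf_le' m.isMaximal.isPrime]
    rintro ⟨m', hm', hle⟩
    exact (Finset.mem_erase.1 hm').1 (MaximalSpectrum.ext
      (m'.isMaximal.eq_of_le m.isMaximal.ne_top hle))
  obtain ⟨a, ha, ham⟩ := SetLike.not_le_iff_exists.1 h
  exact ⟨a, ham, fun m' hm' ↦ Finset.inf_le
    (f := MaximalSpectrum.asIdeal) (Finset.mem_erase.2 ⟨hm', Finset.mem_univ _⟩) ha⟩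

lemma mem_jacobson_iff_forall_maximalSpectrum {a : R} :
    a ∈ Ring.jacobson R ↔ ∀ m : MaximalSpectrum R, a ∈ m.asIdeal := by
  rw [Ring.jacobson_eq_sInf_isMaximal, Submodule.mem_sInf]
  exact ⟨fun h m ↦ h _ m.isMaximal, fun h I hI ↦ h ⟨I, hI⟩⟩

lemma exists_mul_sub_one_mem {m : Ideal R} [m.IsMaximal] {a : R} (ha : a ∉ m) :
    ∃ s, s * a - 1 ∈ m := by
  obtain ⟨s, hs⟩ := Ideal.IsMaximal.exists_inv ‹_› ha
  obtain ⟨t, ht, h⟩ := hs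
  exact ⟨s, by rw [← h, sub_add_cancel_left]; exact m.neg_mem ht⟩

variable {E : Type u} [AddCommGroup E] [Module R E]

/-- If `E` is an injective envelope of `R / rad R`, then the elements of `E` annihilated by a
maximal ideal `m` form a copy of `R / m`. -/
lemma IsInjectiveEnvelope.exists_generator [IsArtinianRing R]
    {i : (R ⧸ Ring.jacobson R) →ₗ[R] E} (hi : IsInjectiveEnvelope i) (m : Ideal R)
    [hm : m.IsMaximal] :
    ∃ x : E, x ≠ 0 ∧ (∀ r ∈ m, r • x = 0) ∧
      ∀ y : E, (∀ r ∈ m, r • y = 0) → ∃ r : R, r • x = y := by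
  -- An element of every maximal ideal except m: its class spans the copy of R / m inside R / rad R.
  obtain ⟨a, ham, ha⟩ := exists_notMem_of_isMaximal ⟨m, hm⟩
  let q : R →ₗ[R] R ⧸ Ring.jacobson R := (Ring.jacobson R).mkQ
  have hq (r : R) : i (q r) = 0 ↔ r ∈ Ring.jacobson R := by
    rw [map_eq_zero_iff i hi.injective]
    exact Submodule.Quotient.mk_eq_zero _
  have hqs (r s : R) : i (q (r * s)) = r • i (q s) := by
    rw [← smul_eq_mul, map_smul, map_smul]
  refine ⟨i (q a), fun h ↦ ham ?_, fun r hr ↦ ?_, fun y hy ↦ ?_⟩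
  · exact mem_jacobson_iff_forall_maximalSpectrum.1 ((hq a).1 h) ⟨m, hm⟩
  · rw [← hqs, hq, mem_jacobson_iff_forall_maximalSpectrum]
    intro m'
    by_cases h : m' = ⟨m, hm⟩
    · subst h
      exact Ideal.mul_mem_right _ _ hr
    · exact Ideal.mul_mem_left _ _ (ha m' h)
  by_cases hy₀ : y = 0
  · exact ⟨0, by rw [hy₀, zero_smul]⟩
  -- By essentiality a nonzero multiple r • y lies in the image of i. As m kills y and r is
  -- invertible modulo m, y itself lies there.
  obtain ⟨z, ⟨hz₁, hz₂⟩, hz₀⟩ := (Submodule.ne_bot_iff _).1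
    (mt (hi.essential (Submodule.span R {y})) (by simpa using hy₀))
  obtain ⟨r, rfl⟩ := Submodule.mem_span_singleton.1 hz₁
  obtain ⟨b, hb⟩ := hz₂
  obtain ⟨b, rfl⟩ := Submodule.mkQ_surjective _ b
  replace hb : i (q b) = r • y := hb
  obtain ⟨s, hs⟩ := exists_mul_sub_one_mem (fun hr ↦ hz₀ (hy r hr) : r ∉ m)
  have hy' : i (q (s * b)) = y := by
    have := hy _ hs
    rwa [sub_smul, one_smul, sub_eq_zero, mul_smul, ← hb, ← hqs] at this
  generalize s * b = c at hy'
  have hc (m' : MaximalSpectrum R) (hm' : m' ≠ ⟨m, hm⟩) : c ∈ m'.asIdeal := by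
    obtain ⟨d, hd, hd'⟩ := SetLike.not_le_iff_exists.1 (fun hle : m ≤ m'.asIdeal ↦
      hm' (MaximalSpectrum.ext (hm.eq_of_le m'.isMaximal.ne_top hle).symm))
    have : i (q (d * c)) = 0 := by rw [hqs, hy', hy d hd]
    exact (m'.isMaximal.isPrime.mem_or_mem
      (mem_jacobson_iff_forall_maximalSpectrum.1 ((hq _).1 this) m')).resolve_left hd'
  -- Then c * t * a and c agree modulo every maximal ideal: modulo m because t inverts a, elsewhere
  -- because c vanishes.
  obtain ⟨t, ht⟩ := exists_mul_sub_one_mem ham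
  refine ⟨c * t, ?_⟩
  rw [← hqs, ← hy', ← sub_eq_zero, ← map_sub, ← map_sub, hq,
    mem_jacobson_iff_forall_maximalSpectrum]
  intro m'
  have : c * t * a - c = c * (t * a - 1) := by ring
  rw [this]
  by_cases h : m' = ⟨m, hm⟩
  · subst h
    exact Ideal.mul_mem_left _ _ ht
  · exact Ideal.mul_mem_right _ _ (hc m' h)

variable (R E) in
/-- `E` is an injective module in which the elements annihilated by a maximal ideal `m` form a
copy of `R / m`, for every `m`. -/
structure IsMinimalCogenerator : Prop where
  injective : Module.Injective R E
  exists_generator (m : Ideal R) [m.IsMaximal] : ∃ x : E, x ≠ 0 ∧ (∀ r ∈ m, r • x = 0) ∧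
    ∀ y : E, (∀ r ∈ m, r • y = 0) → ∃ r : R, r • x = y

lemma IsInjectiveEnvelope.isMinimalCogenerator [IsArtinianRing R]
    {i : (R ⧸ Ring.jacobson R) →ₗ[R] E} (hi : IsInjectiveEnvelope i) :
    IsMinimalCogenerator R E :=
  ⟨hi.injective_module, fun m _ ↦ hi.exists_generator m⟩

namespace IsMinimalCogenerator

section

variable (hE : IsMinimalCogenerator R E) {M : Type*} [AddCommGroup M] [Module R M]

include hE

/-- Evaluation at a generator embeds the dual into the elements of E killed by the annihilator of M,
which form a cyclic module over a residue field. -/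
lemma length_dual_le_one [IsSimpleModule R M] : Module.length R (M →ₗ[R] E) ≤ 1 := by
  have := IsSimpleModule.nontrivial R M
  obtain ⟨s, hs⟩ := exists_ne (0 : M)
  let m := Module.annihilator R M
  have : m.IsMaximal := IsSimpleModule.annihilator_isMaximal
  obtain ⟨x, -, hx, hx'⟩ := hE.exists_generator m
  let j : (R ⧸ m) →ₗ[R] E := m.liftQ (LinearMap.toSpanSingleton R E x) fun r hr ↦ hx r hr
  have hj : Module.length R (LinearMap.range j) ≤ 1 := by
    have : IsSimpleModule R (R ⧸ m) := isSimpleModule_iff_quot_maximal.2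
      ⟨m, inferInstance, ⟨LinearEquiv.refl _ _⟩⟩
    rw [← Module.length_eq_one R (R ⧸ m)]
    exact Module.length_le_of_surjective _ j.surjective_rangeRestrict
  let ev : (M →ₗ[R] E) →ₗ[R] LinearMap.range j :=
    (LinearMap.applyₗ s).codRestrict _ fun f ↦ by
      obtain ⟨r, hr⟩ := hx' (f s) fun r hr ↦ by
        rw [← map_smul, Module.mem_annihilator.1 hr, map_zero]
      exact ⟨m.mkQ r, hr⟩
  refine (Module.length_le_of_injective ev fun f g h ↦ ?_).trans hj
  ext t
  obtain ⟨r, rfl⟩ := Submodule.mem_span_singleton.1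
    ((IsSimpleModule.span_singleton_eq_top R hs).symm ▸ Submodule.mem_top : t ∈ Submodule.span R {s})
  rw [map_smul, map_smul]
  exact congrArg (r • ·) (congrArg Subtype.val h)

lemma exists_extension {N : Type*} [AddCommGroup N] [Module R N] (f : M →ₗ[R] N)
    (hf : Function.Injective f) (g : M →ₗ[R] E) : ∃ h : N →ₗ[R] E, h ∘ₗ f = g :=
  have := hE.injective
  Module.Injective.extension_property R E M N f hf g

/-- The cyclic module R x maps onto some R / m, which embeds in E; injectivity extends this map to
M. -/
lemma exists_apply_ne_zero {x : M} (hx : x ≠ 0) : ∃ f : M →ₗ[R] E, f x ≠ 0 := by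
  let p := LinearMap.toSpanSingleton R M x
  obtain ⟨m, hm, hle⟩ := Ideal.exists_le_maximal (LinearMap.ker p) (by
    rw [Ideal.ne_top_iff_one]
    simpa [p] using hx)
  obtain ⟨y, hy, hy', -⟩ := hE.exists_generator m
  obtain ⟨f, hf⟩ := hE.exists_extension ((LinearMap.ker p).liftQ p le_rfl)
    (LinearMap.ker_eq_bot.1 (Submodule.ker_liftQ_eq_bot _ _ _ le_rfl))
    ((LinearMap.ker p).liftQ (LinearMap.toSpanSingleton R E y) fun r hr ↦ hy' r (hle hr))
  refine ⟨f, ?_⟩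
  have h₁ : f (p 1) = (1 : R) • y := LinearMap.congr_fun hf ((LinearMap.ker p).mkQ 1)
  have h₂ : p 1 = x := one_smul R x
  rwa [← h₂, h₁, one_smul]

lemma length_dual_le (hM : IsFiniteLength R M) :
    Module.length R (M →ₗ[R] E) ≤ Module.length R M := by
  induction hM with
  | of_subsingleton =>
    rw [Module.length_eq_zero]
    exact zero_le
  | @of_simple_quotient M _ _ N _ _ ih =>
    have h₁ := Module.length_eq_add_of_exact N.subtype N.mkQ N.subtype_injective N.mkQ_surjective
      (LinearMap.exact_subtype_mkQ N)
    have h₂ := Module.length_eq_add_of_exact (LinearMap.lcomp R E N.mkQ)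
      (LinearMap.lcomp R E N.subtype) (fun f g h ↦ by
        ext x
        exact LinearMap.congr_fun h x) (fun g ↦ hE.exists_extension _ N.subtype_injective g)
      (fun f ↦ ⟨fun hf ↦ ⟨N.liftQ f fun x hx ↦ LinearMap.congr_fun hf ⟨x, hx⟩, by ext; rfl⟩,
        by
          rintro ⟨g, rfl⟩
          ext x
          change g (N.mkQ x) = 0
          rw [N.mkQ_apply, (Submodule.Quotient.mk_eq_zero N).2 x.2, map_zero]⟩)
    rw [h₁, h₂, add_comm, Module.length_eq_one R (M ⧸ N)]
    exact add_le_add ih hE.length_dual_le_one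

end

section

variable (hE : IsMinimalCogenerator R E) [IsArtinianRing R]
  {M : Type*} [AddCommGroup M] [Module R M] [Module.Finite R M]

include hE

lemma isFiniteLength_dual : IsFiniteLength R (M →ₗ[R] E) := by
  have hM : IsFiniteLength R M := isFiniteLength_iff_isNoetherian_isArtinian.2
    ⟨inferInstance, inferInstance⟩
  exact Module.length_ne_top_iff.1 (ne_top_of_le_ne_top (Module.length_ne_top_iff.2 hM)
    (hE.length_dual_le hM))

lemma finite_dual : Module.Finite R (M →ₗ[R] E) := by
  have := (isFiniteLength_iff_isNoetherian_isArtinian.1 (hE.isFiniteLength_dual (M := M))).1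
  infer_instance

/-- E separates points, so M embeds in its double dual, whose length is at most that of M. -/
lemma bijective_eval :
    Function.Bijective (LinearMap.applyₗ : M →ₗ[R] (M →ₗ[R] E) →ₗ[R] E) := by
  have hinj : Function.Injective (LinearMap.applyₗ : M →ₗ[R] (M →ₗ[R] E) →ₗ[R] E) := by
    rw [injective_iff_map_eq_zero]
    intro x hx
    by_contra hx₀
    obtain ⟨f, hf⟩ := hE.exists_apply_ne_zero hx₀
    exact hf (LinearMap.congr_fun hx f)
  refine ⟨hinj, LinearMap.range_eq_top.1 ?_⟩
  by_contra hne
  have := hE.finite_dual (M := M)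
  have := hE.finite_dual (M := M →ₗ[R] E)
  have hM : IsFiniteLength R M := isFiniteLength_iff_isNoetherian_isArtinian.2
    ⟨inferInstance, inferInstance⟩
  have h₁ := Submodule.length_lt hne
  rw [← (LinearEquiv.ofInjective _ hinj).length_eq] at h₁
  exact h₁.not_ge ((hE.length_dual_le hE.isFiniteLength_dual).trans (hE.length_dual_le hM))

end

end IsMinimalCogenerator

end ArtinDuality

section Nakayama

variable {C : Type u} [Category.{v} C] [Abelian C]
  {R : Type*} [CommRing R] {E : Type v} [AddCommGroup E] [Module R E] [Linear R C]

/-- By Yoneda, t is a transformation Hom(-, I) ⟶ D Hom(P, -), and the hypothesis says that its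
components are bijective. -/
lemma isNakayama_of_form {P I : C} (t : (P ⟶ I) →ₗ[R] E)
    (ht : ∀ X : C, Function.Bijective
      (fun g : X ⟶ I ↦ (t ∘ₗ Linear.rightComp R P g : (P ⟶ X) →ₗ[R] E))) :
    IsNakayama R E P I := by
  obtain ⟨g, hg⟩ := (yonedaForm_bijective R E P I).2 t
  have (Z : Cᵒᵖ) : IsIso (g.app Z) := by
    rw [ConcreteCategory.isIso_iff_bijective]
    have : toForm ∘ (g.app Z) =
        fun s : Z.unop ⟶ I ↦ (t ∘ₗ Linear.rightComp R P s : (P ⟶ Z.unop) →ₗ[R] E) := by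
      funext s
      ext f
      exact (yonedaForm_apply g s f).trans (by rw [hg]; rfl)
    exact (Function.Bijective.of_comp_iff' ⟨toForm_injective, fun φ ↦ ⟨ofForm φ, rfl⟩⟩ _).1
      (this ▸ ht Z.unop)
  have : IsIso g := NatIso.isIso_of_isIso_app g
  exact ⟨asIso g⟩

end Nakayama

/-! ### The modules Hom_R(Λⁿ, E) -/

section Coinduced

variable (R : Type*) [CommRing R] (Λ : Type*) [Ring Λ] [Algebra R Λ]
  (E : Type*) [AddCommGroup E] [Module R E] (n : ℕ)

/-- The right `Λ`-module `Hom_R(Λⁿ, E)`. -/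
def Coinduced := (Fin n → Λ) →ₗ[R] E

namespace Coinduced

instance : AddCommGroup (Coinduced R Λ E n) := inferInstanceAs (AddCommGroup ((Fin n → Λ) →ₗ[R] E))

instance : Module R (Coinduced R Λ E n) := inferInstanceAs (Module R ((Fin n → Λ) →ₗ[R] E))

instance : FunLike (Coinduced R Λ E n) (Fin n → Λ) E :=
  inferInstanceAs (FunLike ((Fin n → Λ) →ₗ[R] E) _ _)

instance : LinearMapClass (Coinduced R Λ E n) R (Fin n → Λ) E :=
  inferInstanceAs (LinearMapClass ((Fin n → Λ) →ₗ[R] E) R _ _)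

variable {R Λ E n}

@[ext]
lemma ext {φ ψ : Coinduced R Λ E n} (h : ∀ v, φ v = ψ v) : φ = ψ := DFunLike.ext _ _ h

@[simp]
lemma add_apply (φ ψ : Coinduced R Λ E n) (v : Fin n → Λ) : (φ + ψ) v = φ v + ψ v := rfl

@[simp]
lemma zero_apply (v : Fin n → Λ) : (0 : Coinduced R Λ E n) v = 0 := rfl

@[simp]
lemma smul_apply (r : R) (φ : Coinduced R Λ E n) (v : Fin n → Λ) : (r • φ) v = r • φ v := rfl

instance : SMul Λᵐᵒᵖ (Coinduced R Λ E n) where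
  smul a φ :=
    { toFun v := φ (a.unop • v)
      map_add' v w := by rw [smul_add, map_add]
      map_smul' r v := by rw [smul_comm, map_smul, RingHom.id_apply] }

@[simp]
lemma op_smul_apply (a : Λᵐᵒᵖ) (φ : Coinduced R Λ E n) (v : Fin n → Λ) :
    (a • φ) v = φ (a.unop • v) := rfl

instance : Module Λᵐᵒᵖ (Coinduced R Λ E n) where
  one_smul φ := by ext v; simp
  mul_smul a b φ := by ext v; simp [mul_smul]
  smul_zero a := by ext v; simp
  smul_add a φ ψ := by ext v; simp
  add_smul a b φ := by ext v; simp [add_smul]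
  zero_smul φ := by ext v; simp

instance : IsScalarTower R Λᵐᵒᵖ (Coinduced R Λ E n) where
  smul_assoc r a φ := by ext v; simp [smul_assoc]

end Coinduced

variable {R Λ E n} {X : Type*} [AddCommGroup X] [Module Λᵐᵒᵖ X]

/-- The linear form on `Hom((Λᵐᵒᵖ)ⁿ, Hom_R(Λⁿ, E))` given by the trace. -/
def coinducedForm (f : (Fin n → Λᵐᵒᵖ) →ₗ[Λᵐᵒᵖ] Coinduced R Λ E n) : E :=
  ∑ i, f (Pi.single i 1) (Pi.single i 1)

/-- Composition with the maps Λⁿ ⟶ X sending the i-th basis vector to x vᵢ recovers g from its trace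
form; this gives injectivity in `isNakayama_coinduced`. -/
lemma coinducedForm_linearCombination (g : X →ₗ[Λᵐᵒᵖ] Coinduced R Λ E n) (x : X)
    (v : Fin n → Λ) :
    coinducedForm (g ∘ₗ Fintype.linearCombination Λᵐᵒᵖ (fun i ↦ MulOpposite.op (v i) • x)) = g x v := by
  simp only [coinducedForm, LinearMap.comp_apply, Fintype.linearCombination_apply_single,
    one_smul, map_smul, Coinduced.op_smul_apply, MulOpposite.unop_op]
  rw [← map_sum]
  congr 1
  ext i
  simp [Finset.sum_apply, Pi.single_apply]

variable [Module R X] [IsScalarTower R Λᵐᵒᵖ X]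

/-- The formula of `coinducedForm_linearCombination` forces g x v = ψ (c x v), and f is the sum of
the maps c (f eᵢ) eᵢ over the basis vectors eᵢ. -/
lemma exists_coinduced [SMulCommClass Λᵐᵒᵖ R X]
    (ψ : ((Fin n → Λᵐᵒᵖ) →ₗ[Λᵐᵒᵖ] X) →ₗ[R] E) :
    ∃ g : X →ₗ[Λᵐᵒᵖ] Coinduced R Λ E n, ∀ f, coinducedForm (g ∘ₗ f) = ψ f := by
  let c (x : X) (v : Fin n → Λ) : (Fin n → Λᵐᵒᵖ) →ₗ[Λᵐᵒᵖ] X :=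
    Fintype.linearCombination Λᵐᵒᵖ (fun i ↦ MulOpposite.op (v i) • x)
  have hc (x : X) (v : Fin n → Λ) (i : Fin n) : c x v (Pi.single i 1) = MulOpposite.op (v i) • x := by
    simp [c]
  let g : X →ₗ[Λᵐᵒᵖ] Coinduced R Λ E n :=
    { toFun x :=
        { toFun v := ψ (c x v)
          map_add' v w := by
            rw [← map_add]
            congr 1
            ext i
            simp [hc, add_smul]
          map_smul' r v := by
            rw [RingHom.id_apply, ← map_smul]
            congr 1
            ext i
            simp [hc] }
      map_add' x y := by
        ext v
        change ψ (c (x + y) v) = ψ (c x v) + ψ (c y v)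
        rw [← map_add]
        congr 1
        ext i
        simp [hc]
      map_smul' a x := by
        ext v
        change ψ (c (a • x) v) = ψ (c x (a.unop • v))
        congr 1
        ext i
        simp [hc, mul_smul] }
  refine ⟨g, fun f ↦ ?_⟩
  change ∑ i, ψ (c (f (Pi.single i 1)) (Pi.single i 1)) = ψ f
  rw [← map_sum]
  congr 1
  ext i
  simp only [LinearMap.comp_apply, LinearMap.sum_apply, LinearMap.single_apply, hc]
  rw [Finset.sum_eq_single i (fun j _ hj ↦ by simp [Pi.single_eq_of_ne hj.symm]) (by simp)]
  simp

/-- For generators φᵢ of D X, send x to v ↦ ∑ φᵢ(x vᵢ). Basis vectors v recover every φᵢ(x), and the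
forms on X separate points. -/
lemma exists_injective_coinduced {R : Type u} [CommRing R] [IsArtinianRing R]
    {E : Type u} [AddCommGroup E] [Module R E] (hE : IsMinimalCogenerator R E)
    {Λ : Type*} [Ring Λ] [Algebra R Λ]
    {X : Type*} [AddCommGroup X] [Module Λᵐᵒᵖ X] [Module R X] [IsScalarTower R Λᵐᵒᵖ X]
    [Module.Finite R X] :
    ∃ (n : ℕ) (g : X →ₗ[Λᵐᵒᵖ] Coinduced R Λ E n), Function.Injective g := by
  have := hE.finite_dual (M := X)
  obtain ⟨n, φ, hφ⟩ := Module.Finite.exists_fin (R := R) (M := X →ₗ[R] E)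
  let g : X →ₗ[Λᵐᵒᵖ] Coinduced R Λ E n :=
    { toFun x :=
        { toFun v := ∑ i, φ i (MulOpposite.op (v i) • x)
          map_add' v w := by simp [add_smul, Finset.sum_add_distrib]
          map_smul' r v := by simp [Finset.smul_sum] }
      map_add' x y := by
        ext v
        change ∑ i, φ i (MulOpposite.op (v i) • (x + y)) =
          ∑ i, φ i (MulOpposite.op (v i) • x) + ∑ i, φ i (MulOpposite.op (v i) • y)
        simp [Finset.sum_add_distrib]
      map_smul' a x := by
        ext v
        change ∑ i, φ i (MulOpposite.op (v i) • a • x) =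
          ∑ i, φ i (MulOpposite.op ((a.unop • v) i) • x)
        simp [mul_smul] }
  refine ⟨n, g, (injective_iff_map_eq_zero g).2 fun x hx ↦ ?_⟩
  by_contra hx₀
  obtain ⟨f, hf⟩ := hE.exists_apply_ne_zero hx₀
  have hle : Submodule.span R (Set.range φ) ≤ LinearMap.ker (LinearMap.applyₗ x) := by
    rw [Submodule.span_le]
    rintro _ ⟨i, rfl⟩
    have h : ∑ j, φ j (MulOpposite.op ((Pi.single i 1 : Fin n → Λ) j) • x) = 0 :=
      congrArg (fun ψ ↦ ψ (Pi.single i 1)) hx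
    rw [Finset.sum_eq_single i (fun j _ hj ↦ by simp [Pi.single_eq_of_ne hj]) (by simp)] at h
    simpa using h
  exact hf (hle (hφ ▸ Submodule.mem_top (x := f)))

end Coinduced

/-! ### Finitely generated right modules over an artin algebra -/

namespace ModFG

variable {R : Type u} [CommRing R] {Λ : Type u} [Ring Λ] [Algebra R Λ]

/-- The underlying type of a finitely generated right module. -/
def carrier (X : ModFG R Λ) : Type u := FGModuleCat.carrier X

instance (X : ModFG R Λ) : AddCommGroup X.carrier :=
  inferInstanceAs (AddCommGroup (FGModuleCat.carrier X))

instance (X : ModFG R Λ) : Module Λᵐᵒᵖ X.carrier :=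
  inferInstanceAs (Module Λᵐᵒᵖ (FGModuleCat.carrier X))

instance (X : ModFG R Λ) : Module.Finite Λᵐᵒᵖ X.carrier :=
  X.property

instance (X : ModFG R Λ) : Module R X.carrier := Module.compHom _ (algebraMap R Λᵐᵒᵖ)

instance (X : ModFG R Λ) : IsScalarTower R Λᵐᵒᵖ X.carrier where
  smul_assoc _ _ _ := by rw [Algebra.smul_def, mul_smul]; rfl

instance (X : ModFG R Λ) : SMulCommClass Λᵐᵒᵖ R X.carrier :=
  IsScalarTower.to_smulCommClass'

instance [Module.Finite R Λ] (X : ModFG R Λ) : Module.Finite R X.carrier :=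
  Module.Finite.trans Λᵐᵒᵖ X.carrier

/-- A finitely generated right module as an object of `mod Λ`. -/
def of (R : Type u) [CommRing R] {Λ : Type u} [Ring Λ] [Algebra R Λ]
    (V : Type u) [AddCommGroup V] [Module Λᵐᵒᵖ V] [Module.Finite Λᵐᵒᵖ V] : ModFG R Λ :=
  FGModuleCat.of Λᵐᵒᵖ V

/-- Morphisms of `mod Λ` are the `Λ`-linear maps. -/
def homEquiv (X Y : ModFG R Λ) : (X ⟶ Y) ≃ₗ[R] (X.carrier →ₗ[Λᵐᵒᵖ] Y.carrier) where
  toFun f := (InducedCategory.Hom.hom f).hom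
  invFun f := ObjectProperty.homMk (ModuleCat.ofHom f)
  left_inv _ := rfl
  right_inv _ := rfl
  map_add' _ _ := rfl
  map_smul' _ _ := rfl

lemma homEquiv_comp {X Y Z : ModFG R Λ} (f : X ⟶ Y) (g : Y ⟶ Z) :
    homEquiv X Z (f ≫ g) = homEquiv Y Z g ∘ₗ homEquiv X Y f := rfl

lemma epi_of_surjective {X Y : ModFG R Λ} (f : X ⟶ Y)
    (hf : Function.Surjective (homEquiv X Y f)) : Epi f where
  left_cancellation g h w := by
    apply (homEquiv _ _).injective
    have := congrArg (homEquiv _ _) w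
    rw [homEquiv_comp, homEquiv_comp] at this
    exact LinearMap.ext fun y ↦ by
      obtain ⟨x, rfl⟩ := hf y
      exact LinearMap.congr_fun this x

lemma mono_of_injective {X Y : ModFG R Λ} (f : X ⟶ Y)
    (hf : Function.Injective (homEquiv X Y f)) : Mono f where
  right_cancellation g h w := by
    apply (homEquiv _ _).injective
    have := congrArg (homEquiv _ _) w
    rw [homEquiv_comp, homEquiv_comp] at this
    exact LinearMap.ext fun z ↦ hf (LinearMap.congr_fun this z)

lemma isHomFinite [IsNoetherianRing R] [Module.Finite R Λ] : IsHomFinite R (ModFG R Λ) := by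
  intro X Y
  obtain ⟨n, x, hx⟩ := Module.Finite.exists_fin (R := Λᵐᵒᵖ) (M := X.carrier)
  let ev : (X ⟶ Y) →ₗ[R] (Fin n → Y.carrier) :=
    { toFun f i := homEquiv X Y f (x i)
      map_add' _ _ := rfl
      map_smul' _ _ := rfl }
  refine Module.Finite.of_injective ev fun f g h ↦ (homEquiv X Y).injective ?_
  refine LinearMap.ext_on hx ?_
  rintro _ ⟨i, rfl⟩
  exact congrFun h i

section

variable [IsArtinianRing R] [Module.Finite R Λ] {E : Type u} [AddCommGroup E] [Module R E]

lemma finite_coinduced (hE : IsMinimalCogenerator R E) (n : ℕ) :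
    Module.Finite Λᵐᵒᵖ (Coinduced R Λ E n) :=
  have : Module.Finite R (Coinduced R Λ E n) := hE.finite_dual (M := Fin n → Λ)
  Module.Finite.of_restrictScalars_finite R Λᵐᵒᵖ _

lemma isNakayama_coinduced (hE : IsMinimalCogenerator R E) (n : ℕ) :
    have := finite_coinduced (Λ := Λ) hE n
    IsNakayama R E (of R (Fin n → Λᵐᵒᵖ) : ModFG R Λ) (of R (Coinduced R Λ E n)) := by
  intro
  let t : ((of R (Fin n → Λᵐᵒᵖ) : ModFG R Λ) ⟶ of R (Coinduced R Λ E n)) →ₗ[R] E :=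
    { toFun f := coinducedForm (homEquiv _ _ f)
      map_add' f g := Finset.sum_add_distrib
      map_smul' r f := by
        refine Eq.trans ?_ Finset.smul_sum.symm
        refine Finset.sum_congr rfl fun i _ ↦ ?_
        let φ : Coinduced R Λ E n := homEquiv _ _ f (Pi.single i 1)
        -- In mod Λ the ring R acts through Λᵐᵒᵖ; on forms this agrees with the pointwise action.
        change (algebraMap R Λᵐᵒᵖ r • φ) (Pi.single i 1) = r • φ (Pi.single i 1)
        rw [algebraMap_smul, Coinduced.smul_apply] }
  refine isNakayama_of_form t fun X ↦ ⟨fun g g' h ↦ ?_, fun ψ ↦ ?_⟩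
  · apply (homEquiv _ _).injective
    refine LinearMap.ext fun x ↦ Coinduced.ext fun v ↦ ?_
    have := LinearMap.congr_fun h ((homEquiv _ _).symm
      (Fintype.linearCombination Λᵐᵒᵖ (fun i ↦ MulOpposite.op (v i) • x)))
    exact (coinducedForm_linearCombination _ x v).symm.trans
      (this.trans (coinducedForm_linearCombination _ x v))
  · let P : ModFG R Λ := of R (Fin n → Λᵐᵒᵖ)
    let ψ' : (P.carrier →ₗ[Λᵐᵒᵖ] X.carrier) →ₗ[R] E := ψ ∘ₗ (homEquiv P X).symm.toLinearMap
    obtain ⟨g, hg⟩ := exists_coinduced (n := n) ψ'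
    exact ⟨(homEquiv _ _).symm g, LinearMap.ext fun f ↦ hg (homEquiv _ _ f)⟩

lemma exists_epi_of_isNakayama (hE : IsMinimalCogenerator R E) (M : ModFG R Λ) :
    ∃ (P I : ModFG R Λ) (p : P ⟶ M), Epi p ∧ IsNakayama R E P I := by
  obtain ⟨n, f, hf⟩ := Module.Finite.exists_fin' Λᵐᵒᵖ M.carrier
  have := finite_coinduced (Λ := Λ) hE n
  exact ⟨of R (Fin n → Λᵐᵒᵖ), of R (Coinduced R Λ E n), (homEquiv _ _).symm f,
    epi_of_surjective _ hf, isNakayama_coinduced hE n⟩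

lemma exists_mono_of_isNakayama (hE : IsMinimalCogenerator R E) (M : ModFG R Λ) :
    ∃ (P I : ModFG R Λ) (i : M ⟶ I), Mono i ∧ IsNakayama R E P I := by
  obtain ⟨n, g, hg⟩ := exists_injective_coinduced (Λ := Λ) (X := M.carrier) hE
  have := finite_coinduced (Λ := Λ) hE n
  exact ⟨of R (Fin n → Λᵐᵒᵖ), of R (Coinduced R Λ E n), (homEquiv _ _).symm g,
    mono_of_injective _ hg, isNakayama_coinduced hE n⟩

end

end ModFG

end KbSerre

end

/-! ### The theorem for artin algebras -/

open KbSerre in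
theorem mainTheorem11
    (R : Type u) [CommRing R] [IsArtinianRing R]
    (Λ : Type u) [Ring Λ] [Algebra R Λ] [Module.Finite R Λ]
    (E : Type u) [AddCommGroup E] [Module R E]
    (i : (R ⧸ Ring.jacobson R) →ₗ[R] E) (hi : IsInjectiveEnvelope i)
    [HasDerivedCategory.{w} (Coh (ModFG R Λ))] :
    IsHomFinite R (Kb (ModFG R Λ)) ∧
    IsKrullSchmidt (Kb (ModFG R Λ)) ∧
    IsTriangleEquivalence (yonedaDb (ModFG R Λ)) ∧
    ∃ (h : ∀ M : ModFG R Λ, coherent (ModFG R Λ) ((dualRepresentable R E (ModFG R Λ)).obj M))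
      (V : Db (Coh (ModFG R Λ)) ⥤ Db (Coh (ModFG R Λ)))
      (U : Kb (ModFG R Λ) ⥤ Kb (ModFG R Λ)),
      IsTriangleEquivalence V ∧
      Nonempty (yonedaDb (ModFG R Λ) ⋙ V ≅ dualRepresentableDb h) ∧
      IsTriangleEquivalence U ∧
      IsSerreFunctor R E U ∧
      Nonempty (U ⋙ yonedaDb (ModFG R Λ) ≅ yonedaDb (ModFG R Λ) ⋙ V) := by
  have hE := hi.isMinimalCogenerator
  have := hE.injective
  have hC : IsHomFinite R (ModFG R Λ) := ModFG.isHomFinite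
  exact ⟨isHomFinite_Kb hC, isKrullSchmidt_Kb hC, isTriangleEquivalence_yonedaDb _,
    exists_serreFunctor hC (ModFG.exists_epi_of_isNakayama hE) (ModFG.exists_mono_of_isNakayama hE)
      fun _ _ _ _ ↦ hE.bijective_eval⟩
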